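/- Let $\nu$ be a Lévy measure on $\mathbb R$ (that is, $\nu(\{0\})=0$ and $\int \min(1,y^2)\,\nu(dy)<\infty$), let $n\ge 2$ be an even integer, and assume $\int_{\mathbb R}|y|^n\,\nu(dy)<\infty$. For $\Lambda>0$ let $$\mathcal E_n(\Lambda)=\inf_{\bar\nu}\int_{\mathbb R}|y|^n\,|\nu-\bar\nu|(dy),$$ where $|\nu-\bar\nu|$ is the variation measure of $\nu-\bar\nu$ and the infimum runs over all finite positive measures $\bar\nu$ on $\mathbb R$ with $\bar\nu(\mathbb R)=\Lambda$ and $\int y^k\,\bar\nu(dy)=\int y^k\,\nu(dy)$ (with $\int|y|^k\,\bar\nu(dy)<\infty$) for $k=2,\dots,n-1$ (the infimum over the empty set is $+\infty$). A function is regularly varying of index $\rho$ at infinity (at zero) if it is positive and measurable on a neighbourhood of infinity (on some interval $(0,\delta)$) and, for every $l>0$, its value at $lx$ divided by its value at $x$ tends to $l^{\rho}$ as $x\to\infty$ (as $x\downarrow0$). Assume $(R_\alpha)$: there are $\alpha\in(0,2)$, constants $c_+,c_-\ge 0$ with $c_++c_->0$, and a function $g$ that is regularly varying of index $-\alpha$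 at zero, such that $$\frac{\nu((x,\infty))}{g(x)}\to c_+\quad\text{and}\quad \frac{\nu((-\infty,-x))}{g(x)}\to c_-\qquad\text{as } x\downarrow 0 .$$ By a generalized inverse of $g$ we mean a function $h$, measurable near infinity, with $h(\Lambda)>0$ for large $\Lambda$, $h(\Lambda)\to 0$ and $g(h(\Lambda))/\Lambda\to 1$ as $\Lambda\to\infty$. Then: 1. $g^{\leftarrow}(\Lambda)=\inf\{x>0: g(x)<\Lambda\}$ is a generalized inverse of $g$. 2. For every generalized inverse $h$ of $g$ (in particular for $h=g^{\leftarrow}$), the function $f(\Lambda)=(h(\Lambda))^n\Lambda$ is regularly varying of index $1-n/\alpha$ at infinity, and there are constants $0<\underline c\le\overline c<\infty$ such that $$\underline c\,f(\Lambda)\le \mathcal E_n(\Lambda)\le\overline c\,f(\Lambda)\qquad\text{for all sufficiently large }\Lambda .$$ 3. Consequently $\Lambda^{p}\,\mathcal E_n(\Lambda)\to 0$ as $\Lambda\to\infty$ for every real $p<n/\alpha-1$; thus, if $\nu$ has moments of all orders, moment-matching compound Poisson approximations of arbitrarily high order are obtained by taking $n$ large. -/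

import Mathlib

open MeasureTheory Filter Topology Set
open scoped ENNReal

noncomputable section

/-- A Lévy measure on `ℝ`: no mass at the origin, and `∫ min(1, y²) ν(dy) < ∞`. -/
structure IsLevyMeasure (ν : Measure ℝ) : Prop where
  zero_singleton : ν {0} = 0
  lintegral_lt_top : ∫⁻ y, ENNReal.ofReal (min 1 (y ^ 2)) ∂ν < ∞

/-- `f ∈ R_ρ` at infinity: `f` is positive and (Lebesgue) measurable on some half-line `(X, ∞)`,
and `f (l x) / f x → l ^ ρ` as `x → ∞`, for every `l > 0`. -/
structure IsRegularlyVaryingAtTop (f : ℝ → ℝ) (ρ : ℝ) : Prop where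
  pos_measurable : ∃ X : ℝ, (∀ x ∈ Ioi X, 0 < f x) ∧ AEMeasurable f (volume.restrict (Ioi X))
  tendsto_ratio : ∀ l : ℝ, 0 < l → Tendsto (fun x => f (l * x) / f x) atTop (𝓝 (l ^ ρ))

/-- `g ∈ R_ρ` at zero: `g` is positive and (Lebesgue) measurable on some interval `(0, δ)`,
and `g (l x) / g x → l ^ ρ` as `x ↓ 0`, for every `l > 0`. -/
structure IsRegularlyVaryingAtZero (g : ℝ → ℝ) (ρ : ℝ) : Prop where
  pos_measurable : ∃ δ : ℝ, 0 < δ ∧ (∀ x ∈ Ioo 0 δ, 0 < g x) ∧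
    AEMeasurable g (volume.restrict (Ioo 0 δ))
  tendsto_ratio : ∀ l : ℝ, 0 < l → Tendsto (fun x => g (l * x) / g x) (𝓝[>] 0) (𝓝 (l ^ ρ))

/-- Assumption `(R_α)` on the Lévy measure `ν`, with its data `g`, `c₊`, `c₋`. The relation
`u ~ c g` means `u / g → c`, so that one of the two constants may vanish. -/
structure RegularVariationAssumption (ν : Measure ℝ) (α : ℝ) (g : ℝ → ℝ) (cp cm : ℝ) : Prop where
  alpha_mem : α ∈ Ioo (0 : ℝ) 2
  cp_nonneg : 0 ≤ cp
  cm_nonneg : 0 ≤ cm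
  sum_pos : 0 < cp + cm
  regularlyVarying : IsRegularlyVaryingAtZero g (-α)
  tendsto_right : Tendsto (fun x => ν.real (Ioi x) / g x) (𝓝[>] 0) (𝓝 cp)
  tendsto_left : Tendsto (fun x => ν.real (Iio (-x)) / g x) (𝓝[>] 0) (𝓝 cm)

/-- The variation measure `|ν - ν'|`, the sum of the positive and the negative part
of `ν - ν'`. (The difference of measures `ν - ν'` is the least measure `τ` with `ν ≤ τ + ν'`.) -/
def variationOfDiff (ν ν' : Measure ℝ) : Measure ℝ := (ν - ν') + (ν' - ν)

/-- The functional `J(ν') = ∫ |y|^n |ν - ν'|(dy)`, with values in `[0, ∞]`. -/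
def errorFunctional (n : ℕ) (ν ν' : Measure ℝ) : ℝ≥0∞ :=
  ∫⁻ y, ENNReal.ofReal (|y| ^ n) ∂(variationOfDiff ν ν')

/-- The finite measures `ν'` on `ℝ` that satisfy the constraints of the problem `Ω_{n,Λ}`:
`ν'(ℝ) = Λ` and `∫ y^k ν'(dy) = ∫ y^k ν(dy)` for `k = 2, …, n - 1`. -/
def admissibleMeasures (n : ℕ) (ν : Measure ℝ) (Λ : ℝ) : Set (Measure ℝ) :=
  {ν' | ν' univ = ENNReal.ofReal Λ ∧
    ∀ k : ℕ, 2 ≤ k → k < n →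
      Integrable (fun y : ℝ => y ^ k) ν' ∧ ∫ y, y ^ k ∂ν' = ∫ y, y ^ k ∂ν}

/-- The optimal value `ℰ_n(Λ)` of the problem `Ω_{n,Λ}` (it is `∞` if there is no
admissible measure). -/
def optimalError (n : ℕ) (ν : Measure ℝ) (Λ : ℝ) : ℝ≥0∞ :=
  ⨅ ν' ∈ admissibleMeasures n ν Λ, errorFunctional n ν ν'

/-- The generalized inverse `g^←(Λ) = inf {x > 0 : g x < Λ}` of a function that explodes at `0`. -/
def generalizedInverse (g : ℝ → ℝ) (Λ : ℝ) : ℝ := sInf {x | 0 < x ∧ g x < Λ}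

/-- `h` is a generalized (asymptotic) inverse near infinity of a function `g` that explodes
at `0`: `h` is measurable near infinity, `h(Λ) ↓ 0` through positive values and `g(h(Λ)) ~ Λ` as
`Λ → ∞`. -/
structure IsAsymptoticInverse (g h : ℝ → ℝ) : Prop where
  measurable : ∃ X : ℝ, AEMeasurable h (volume.restrict (Ioi X))
  tendsto_zero : Tendsto h atTop (𝓝[>] 0)
  tendsto_comp : Tendsto (fun Λ => g (h Λ) / Λ) atTop (𝓝 1)

/-- The rate `f(Λ) = (h(Λ))^n Λ` attached to a generalized inverse `h`. -/
def errorRate (n : ℕ) (h : ℝ → ℝ) (Λ : ℝ) : ℝ := h Λ ^ n * Λ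

end

/-!
The tail `U x = ν {|y| > x}` (`levyTail`) is nonincreasing and `U ~ (c₊ + c₋) g` at zero. Everything
about `g` is therefore read off a *monotone* regularly varying function (`IsRegularTail`), and no
uniform convergence theorem is needed: `g^←` is an asymptotic inverse because `g x`, for `x` between
`h` and `a h`, is squeezed through `U`; an asymptotic inverse `h` satisfies `U (h Λ) ~ c Λ`, whence
`h (l Λ) / h Λ → l ^ (-1/α)`; and iterating `U (x / 2) ≤ B U x` gives Potter type bounds and
Karamata's bound `∫_{|y| ≤ x} y² dν ≤ K x² U x`.

Lower bound (`IsLevyMeasure.le_optimalError`): an admissible measure has mass `Λ` only, while for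
small `a` the tail `U (a h)` exceeds `2 Λ`. So a mass at least `Λ` of `ν` beyond distance `a h` is
missed, at a cost of at least `(a h) ^ n Λ`. The moments play no role here.

Upper bound (`optimalError_le`): with `ε = A h` and `A` large, keep `ν` on `|y| > ε`, replace the
rest of `ν` by a finitely supported measure `μ` on an annulus `δ ε ≤ |y| ≤ ε` with the same moments
of order `2, …, n`, and complete the mass to `Λ` by an atom at the origin. The mass of `μ` is at most
its second moment divided by `(δ ε)²`, that is `O(U ε)`, which fits into `Λ` when `A` is large.
The error is at most twice the `n`-th moment of `ν` over `|y| ≤ ε`, hence `O(ε ^ n U ε)`.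

The existence of `μ`, with `δ` independent of `ε`, is the heart of the matter
(`IsLevyMeasure.exists_matching_measure`). By separation of a point from the convex hull of the
moment curve (`moments_mem_convexHull`), it amounts to `∫_{|y| ≤ ε} r(y) y² ν(dy) ≥ 0` for every
polynomial `r` of degree at most `n - 2` that is nonnegative on the annulus. By regular variation,
`n - 1` separated shells in `ε / 2 ≤ |y| ≤ ε`, on one side of the origin, carry a mass of order `U ε`.
Lagrange interpolation at minimum points of `r` on these shells bounds `r` on `[-ε, ε]` by the sum of
its values there, so the shells outweigh the contribution of `|y| ≤ δ ε`, which Karamata's bound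
makes small with `δ` (`setIntegral_eval_mul_sq_nonneg`).
-/

/-! ### Monotone regularly varying functions at zero -/

/-- A nonincreasing function on `(0, ∞)` that is positive near `0` and regularly varying of
index `-α` at `0`. Monotonicity replaces the uniform convergence theorem in everything below. -/
structure IsRegularTail (U : ℝ → ℝ) (α : ℝ) : Prop where
  anti : AntitoneOn U (Ioi 0)
  pos : ∀ᶠ x in 𝓝[>] (0 : ℝ), 0 < U x
  ratio : ∀ l : ℝ, 0 < l → Tendsto (fun x => U (l * x) / U x) (𝓝[>] 0) (𝓝 (l ^ (-α)))

theorem eventually_nhdsGT_zero_iff {P : ℝ → Prop} :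
    (∀ᶠ x in 𝓝[>] (0 : ℝ), P x) ↔ ∃ x₀ : ℝ, 0 < x₀ ∧ ∀ x, 0 < x → x ≤ x₀ → P x := by
  constructor
  · intro h
    obtain ⟨u, hu, hsub⟩ := (mem_nhdsGT_iff_exists_Ioc_subset (a := (0 : ℝ))).1 h
    exact ⟨u, hu, fun x h0 h1 => hsub ⟨h0, h1⟩⟩
  · rintro ⟨u, hu, h⟩
    exact (mem_nhdsGT_iff_exists_Ioc_subset (a := (0 : ℝ))).2 ⟨u, hu, fun x hx => h x hx.1 hx.2⟩

theorem tendsto_const_mul_nhdsGT_zero {a : ℝ} (ha : 0 < a) :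
    Tendsto (fun x : ℝ => a * x) (𝓝[>] 0) (𝓝[>] 0) := by
  refine tendsto_nhdsWithin_iff.2 ⟨?_, ?_⟩
  · have : Tendsto (fun x : ℝ => a * x) (𝓝 0) (𝓝 (a * 0)) := tendsto_id.const_mul a
    rw [mul_zero] at this
    exact this.mono_left nhdsWithin_le_nhds
  · filter_upwards [self_mem_nhdsWithin] with x hx
    exact mul_pos ha hx

namespace IsRegularTail

variable {U : ℝ → ℝ} {α : ℝ}

theorem eventually_halving (hU : IsRegularTail U α) {B : ℝ} (hB : (2 : ℝ) ^ α < B) :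
    ∀ᶠ x in 𝓝[>] (0 : ℝ), 0 < U x ∧ U (x / 2) ≤ B * U x := by
  have h2 : ((1 : ℝ) / 2) ^ (-α) = 2 ^ α := by
    rw [Real.rpow_neg (by norm_num), one_div, Real.inv_rpow (by norm_num), inv_inv]
  have h := hU.ratio (1 / 2) (by norm_num)
  rw [h2] at h
  filter_upwards [hU.pos, h.eventually (gt_mem_nhds hB)] with x hx hlt
  refine ⟨hx, ?_⟩
  rw [div_lt_iff₀ hx] at hlt
  rw [show x / 2 = 1 / 2 * x by ring]
  exact hlt.le

theorem eventually_doubling (hU : IsRegularTail U α) {r : ℝ} (hr : r < (2 : ℝ) ^ α) :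
    ∀ᶠ x in 𝓝[>] (0 : ℝ), 0 < U x ∧ r * U x ≤ U (x / 2) := by
  have h2 : ((1 : ℝ) / 2) ^ (-α) = 2 ^ α := by
    rw [Real.rpow_neg (by norm_num), one_div, Real.inv_rpow (by norm_num), inv_inv]
  have h := hU.ratio (1 / 2) (by norm_num)
  rw [h2] at h
  filter_upwards [hU.pos, h.eventually (lt_mem_nhds hr)] with x hx hlt
  refine ⟨hx, ?_⟩
  rw [lt_div_iff₀ hx] at hlt
  rw [show x / 2 = 1 / 2 * x by ring]
  exact hlt.le

theorem le_pow_mul_of_halving {x₀ B : ℝ} (hB : 0 ≤ B)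
    (h : ∀ x, 0 < x → x ≤ x₀ → U (x / 2) ≤ B * U x) (m : ℕ) {x : ℝ} (hx : 0 < x) (hx0 : x ≤ x₀) :
    U (x / 2 ^ m) ≤ B ^ m * U x := by
  induction m with
  | zero => simp
  | succ m ih =>
    have hp : (1 : ℝ) ≤ 2 ^ m := one_le_pow₀ (by norm_num)
    have h1 := h (x / 2 ^ m) (by positivity) ((div_le_self hx.le hp).trans hx0)
    calc U (x / 2 ^ (m + 1)) = U (x / 2 ^ m / 2) := by rw [pow_succ, div_div]
      _ ≤ B * U (x / 2 ^ m) := h1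
      _ ≤ B * (B ^ m * U x) := mul_le_mul_of_nonneg_left ih hB
      _ = B ^ (m + 1) * U x := by ring

theorem tendsto_atTop (hU : IsRegularTail U α) (hα : 0 < α) :
    Tendsto U (𝓝[>] 0) atTop := by
  have h1 : (1 : ℝ) < 2 ^ α := Real.one_lt_rpow (by norm_num) hα
  obtain ⟨r, hr1, hr⟩ := exists_between h1
  obtain ⟨x₀, hx₀, h⟩ := eventually_nhdsGT_zero_iff.1 (hU.eventually_doubling hr)
  have hlow : ∀ m : ℕ, r ^ m * U x₀ ≤ U (x₀ / 2 ^ m) := by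
    intro m
    induction m with
    | zero => simp
    | succ m ih =>
      have hp : (1 : ℝ) ≤ 2 ^ m := one_le_pow₀ (by norm_num)
      have h1 := (h (x₀ / 2 ^ m) (by positivity) (div_le_self hx₀.le hp)).2
      calc r ^ (m + 1) * U x₀ = r * (r ^ m * U x₀) := by ring
        _ ≤ r * U (x₀ / 2 ^ m) := mul_le_mul_of_nonneg_left ih (by linarith)
        _ ≤ U (x₀ / 2 ^ m / 2) := h1
        _ = U (x₀ / 2 ^ (m + 1)) := by rw [pow_succ, div_div]
  refine Filter.tendsto_atTop.2 fun b => ?_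
  have hlim : Tendsto (fun m : ℕ => r ^ m * U x₀) atTop atTop :=
    (tendsto_pow_atTop_atTop_of_one_lt hr1).atTop_mul_const (h x₀ hx₀ le_rfl).1
  obtain ⟨m, hm⟩ := (hlim.eventually_ge_atTop b).exists
  refine eventually_nhdsGT_zero_iff.2 ⟨x₀ / 2 ^ m, by positivity, fun x hx hxm => ?_⟩
  exact (hm.trans (hlow m)).trans (hU.anti hx (mem_Ioi.2 (by positivity)) hxm)

/-- A Potter type bound: the tail explodes at most like `x ^ (-β)`, for each `β > α`. -/
theorem exists_le_rpow (hU : IsRegularTail U α) {β : ℝ} (hα : 0 < α) (hβ : α < β) :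
    ∃ C : ℝ, 0 < C ∧ ∀ᶠ x in 𝓝[>] (0 : ℝ), U x ≤ C * x ^ (-β) := by
  have hB : (2 : ℝ) ^ α < 2 ^ β := Real.rpow_lt_rpow_of_exponent_lt (by norm_num) hβ
  obtain ⟨x₀, hx₀, h⟩ := eventually_nhdsGT_zero_iff.1 (hU.eventually_halving hB)
  have hpos := (h x₀ hx₀ le_rfl).1
  refine ⟨(2 * x₀) ^ β * U x₀, by positivity,
    eventually_nhdsGT_zero_iff.2 ⟨x₀, hx₀, fun x hx hxx => ?_⟩⟩
  obtain ⟨k, hk1, hk2⟩ := exists_nat_pow_near ((one_le_div hx).2 hxx) (one_lt_two (α := ℝ))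
  rw [le_div_iff₀ hx] at hk1
  rw [div_lt_iff₀ hx] at hk2
  calc U x ≤ U (x₀ / 2 ^ (k + 1)) := by
        refine hU.anti (mem_Ioi.2 (by positivity)) hx ?_
        rw [div_le_iff₀ (by positivity)]
        linarith
    _ ≤ ((2 : ℝ) ^ β) ^ (k + 1) * U x₀ :=
        le_pow_mul_of_halving (by positivity) (fun x h0 h1 => (h x h0 h1).2) _ hx₀ le_rfl
    _ = ((2 : ℝ) ^ (k + 1)) ^ β * U x₀ := by
        rw [← Real.rpow_natCast, ← Real.rpow_natCast, ← Real.rpow_mul (by norm_num),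
          ← Real.rpow_mul (by norm_num), mul_comm β]
    _ ≤ (2 * x₀ / x) ^ β * U x₀ := by
        refine mul_le_mul_of_nonneg_right ?_ hpos.le
        refine Real.rpow_le_rpow (by positivity) ?_ (by linarith)
        rw [le_div_iff₀ hx, pow_succ]
        linarith
    _ = (2 * x₀) ^ β * U x₀ * x ^ (-β) := by
        rw [Real.div_rpow (by positivity) hx.le, Real.rpow_neg hx.le]
        ring

theorem ratio_comp (hU : IsRegularTail U α) {h : ℝ → ℝ} {c l : ℝ} (hl : 0 < l)
    (h0 : Tendsto h atTop (𝓝[>] 0)) (hc : Tendsto (fun Λ => U (h Λ) / Λ) atTop (𝓝 c)) :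
    Tendsto (fun Λ => U (l * h Λ) / Λ) atTop (𝓝 (l ^ (-α) * c)) := by
  refine (((hU.ratio l hl).comp h0).mul hc).congr' ?_
  filter_upwards [h0.eventually hU.pos] with Λ hΛ
  simp only [Function.comp]
  field_simp

/-- An asymptotic inverse of a monotone regularly varying tail is regularly varying. If
`h (l Λ) ≥ a h Λ` with `a > l ^ (-1/α)`, then the monotonicity of `U` gives, after division by `Λ`
and passage to the limit, `l ≤ a ^ (-α) < l`; the other side is symmetric. -/
theorem tendsto_inverse_ratio (hU : IsRegularTail U α) (hα : 0 < α) {h : ℝ → ℝ} {c l : ℝ}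
    (hcpos : 0 < c) (hl : 0 < l)
    (h0 : Tendsto h atTop (𝓝[>] 0)) (hc : Tendsto (fun Λ => U (h Λ) / Λ) atTop (𝓝 c)) :
    Tendsto (fun Λ => h (l * Λ) / h Λ) atTop (𝓝 (l ^ (-(1 / α)))) := by
  have hlΛ : Tendsto (fun Λ : ℝ => l * Λ) atTop atTop := tendsto_id.const_mul_atTop hl
  have hpos : ∀ᶠ Λ in atTop, 0 < h Λ := h0.eventually self_mem_nhdsWithin
  have hposl : ∀ᶠ Λ in atTop, 0 < h (l * Λ) := hlΛ.eventually hpos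
  have hcl : Tendsto (fun Λ => U (h (l * Λ)) / Λ) atTop (𝓝 (c * l)) := by
    refine ((hc.comp hlΛ).mul_const l).congr' ?_
    filter_upwards [eventually_gt_atTop 0] with Λ hΛ
    simp only [Function.comp]
    field_simp
  have hpow : (l ^ (-(1 / α))) ^ (-α) = l := by
    rw [← Real.rpow_mul hl.le]
    rw [show -(1 / α) * -α = 1 by field_simp, Real.rpow_one]
  refine tendsto_order.2 ⟨fun a ha => ?_, fun a ha => ?_⟩
  · rcases le_or_gt a 0 with ha0 | ha0
    · filter_upwards [hpos, hposl] with Λ h1 h2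
      exact ha0.trans_lt (by positivity)
    have hlt : l * c < a ^ (-α) * c := by
      refine mul_lt_mul_of_pos_right ?_ hcpos
      calc l = (l ^ (-(1 / α))) ^ (-α) := hpow.symm
        _ < a ^ (-α) := Real.rpow_lt_rpow_of_neg ha0 ha (by linarith)
    filter_upwards [hpos, hposl, eventually_gt_atTop 0,
      hcl.eventually_lt (hU.ratio_comp ha0 h0 hc) (by rwa [mul_comm c])] with Λ h1 h2 h3 h4
    rw [lt_div_iff₀ h1]
    by_contra! hcon
    have := hU.anti h2 (mem_Ioi.2 (by positivity : 0 < a * h Λ)) hcon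
    exact absurd h4 (not_lt.2 (div_le_div_of_nonneg_right this h3.le))
  · have ha0 : 0 < a := lt_trans (by positivity) ha
    have hlt : a ^ (-α) * c < l * c := by
      refine mul_lt_mul_of_pos_right ?_ hcpos
      calc a ^ (-α) < (l ^ (-(1 / α))) ^ (-α) :=
            Real.rpow_lt_rpow_of_neg (by positivity) ha (by linarith)
        _ = l := hpow
    filter_upwards [hpos, hposl, eventually_gt_atTop 0,
      (hU.ratio_comp ha0 h0 hc).eventually_lt hcl (by rwa [mul_comm c])] with Λ h1 h2 h3 h4
    rw [div_lt_iff₀ h1]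
    by_contra! hcon
    have := hU.anti (mem_Ioi.2 (by positivity : 0 < a * h Λ)) h2 hcon
    exact absurd h4 (not_lt.2 (div_le_div_of_nonneg_right this h3.le))

/-- A function equivalent to a monotone regularly varying tail has `g^←` as an asymptotic inverse.
For `a < 1` the definition of the infimum gives `Λ ≤ g (a h)`, and for `a > 1` it gives a point
`x ∈ [h, a h]` with `g x < Λ`; the monotonicity of `U ~ c g` compares `g x` with `g (a h)`. Letting
`a → 1` yields `g (h Λ) ~ Λ`. -/
theorem isAsymptoticInverse_generalizedInverse (hU : IsRegularTail U α) (hα : 0 < α)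
    {g : ℝ → ℝ} {c : ℝ} (hcpos : 0 < c) (hg : IsRegularlyVaryingAtZero g (-α))
    (hUg : Tendsto (fun x => U x / g x) (𝓝[>] 0) (𝓝 c)) :
    IsAsymptoticInverse g (generalizedInverse g) := by
  obtain ⟨δ, hδ, hgpos, -⟩ := hg.pos_measurable
  have hgpos' : ∀ᶠ x in 𝓝[>] (0 : ℝ), 0 < g x := by
    filter_upwards [Ioo_mem_nhdsGT hδ] with x hx using hgpos x hx
  have hgU : Tendsto (fun x => g x / U x) (𝓝[>] 0) (𝓝 c⁻¹) :=
    (hUg.inv₀ hcpos.ne').congr fun x => inv_div _ _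
  have hgtop : Tendsto g (𝓝[>] 0) atTop := by
    refine ((hU.tendsto_atTop hα).atTop_mul_pos (inv_pos.2 hcpos) hgU).congr' ?_
    filter_upwards [hU.pos] with x hx
    field_simp
  set h := generalizedInverse g with hh
  have hbdd : ∀ Λ, BddBelow {x | 0 < x ∧ g x < Λ} := fun Λ => ⟨0, fun x hx => hx.1.le⟩
  have hne : ∀ Λ, g (δ / 2) < Λ → {x | 0 < x ∧ g x < Λ}.Nonempty :=
    fun Λ hΛ => ⟨δ / 2, by positivity, hΛ⟩
  have hposh : ∀ Λ, g (δ / 2) < Λ → 0 < h Λ := by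
    intro Λ hΛ
    obtain ⟨x₀, hx₀, hx⟩ := eventually_nhdsGT_zero_iff.1 (hgtop.eventually_ge_atTop Λ)
    refine hx₀.trans_le (le_csInf (hne Λ hΛ) fun x hxm => ?_)
    by_contra! hlt
    exact absurd hxm.2 (not_lt.2 (hx x hxm.1 hlt.le))
  have hzero : Tendsto h atTop (𝓝[>] 0) := by
    refine tendsto_nhdsWithin_iff.2 ⟨tendsto_order.2 ⟨fun a ha => ?_, fun a ha => ?_⟩, ?_⟩
    · filter_upwards [eventually_gt_atTop (g (δ / 2))] with Λ hΛ using ha.trans (hposh Λ hΛ)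
    · filter_upwards [eventually_gt_atTop (g (a / 2))] with Λ hΛ
      exact (csInf_le (hbdd Λ) ⟨half_pos ha, hΛ⟩).trans_lt (half_lt_self ha)
    · filter_upwards [eventually_gt_atTop (g (δ / 2))] with Λ hΛ using hposh Λ hΛ
  refine ⟨⟨g (δ / 2), ?_⟩, hzero, ?_⟩
  · refine aemeasurable_restrict_of_antitoneOn measurableSet_Ioi fun Λ hΛ Λ' _ hle => ?_
    exact csInf_le_csInf (hbdd Λ') (hne Λ hΛ) fun x hx => ⟨hx.1, hx.2.trans_le hle⟩
  have hg_ratio : ∀ a : ℝ, 0 < a → Tendsto (fun Λ => g (h Λ) / g (a * h Λ)) atTop (𝓝 (a ^ α)) := by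
    intro a ha
    have h1 := ((hg.tendsto_ratio a ha).comp hzero).inv₀ (by positivity)
    rw [← Real.rpow_neg ha.le, neg_neg] at h1
    exact h1.congr fun x => inv_div _ _
  have hcont : ContinuousAt (fun a : ℝ => a ^ α) 1 :=
    Real.continuousAt_rpow_const 1 α (Or.inl one_ne_zero)
  have hlim1 : Tendsto (fun a : ℝ => a ^ α) (𝓝 1) (𝓝 1) := by
    simpa [ContinuousAt] using hcont
  have hgh : ∀ᶠ Λ in atTop, 0 < g (h Λ) := hzero.eventually hgpos'
  refine tendsto_order.2 ⟨fun b hb => ?_, fun b hb => ?_⟩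
  · obtain ⟨a, hab, ha0, ha1⟩ : ∃ a : ℝ, b < a ^ α ∧ 0 < a ∧ a < 1 := by
      have : ∀ᶠ a in 𝓝[<] (1 : ℝ), b < a ^ α :=
        (hlim1.mono_left nhdsWithin_le_nhds).eventually (lt_mem_nhds hb)
      exact (this.and (Ioo_mem_nhdsLT zero_lt_one)).exists
    filter_upwards [(hg_ratio a ha0).eventually (lt_mem_nhds hab), hgh, eventually_gt_atTop 0,
      hzero.eventually self_mem_nhdsWithin] with Λ h1 h2 h3 h4
    have h5 : Λ ≤ g (a * h Λ) := by
      by_contra! hlt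
      have h6 : h Λ ≤ a * h Λ := csInf_le (hbdd Λ) ⟨mul_pos ha0 h4, hlt⟩
      nlinarith [show 0 < h Λ from h4]
    exact h1.trans_le (div_le_div_of_nonneg_left h2.le h3 h5)
  · obtain ⟨a, hab, ha1⟩ : ∃ a : ℝ, a ^ α < b ∧ 1 < a := by
      have : ∀ᶠ a in 𝓝[>] (1 : ℝ), a ^ α < b :=
        (hlim1.mono_left nhdsWithin_le_nhds).eventually (gt_mem_nhds hb)
      exact (this.and self_mem_nhdsWithin).exists
    have ha0 : 0 < a := by linarith
    have hex : ∀ Λ, ∃ x, g (δ / 2) < Λ → h Λ ≤ x ∧ x ≤ a * h Λ ∧ g x < Λ := by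
      intro Λ
      by_cases hΛ : g (δ / 2) < Λ
      · have hlt : h Λ < a * h Λ := by nlinarith [hposh Λ hΛ]
        obtain ⟨x, hx, hxlt⟩ := exists_lt_of_csInf_lt (hne Λ hΛ) hlt
        exact ⟨x, fun _ => ⟨csInf_le (hbdd Λ) hx, hxlt.le, hx.2⟩⟩
      · exact ⟨0, fun h => absurd h hΛ⟩
    choose x hx using hex
    have hah : Tendsto (fun Λ => a * h Λ) atTop (𝓝[>] 0) :=
      (tendsto_const_mul_nhdsGT_zero ha0).comp hzero
    have hx0 : Tendsto x atTop (𝓝[>] 0) := by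
      refine tendsto_nhdsWithin_iff.2 ⟨?_, ?_⟩
      · refine tendsto_of_tendsto_of_tendsto_of_le_of_le' (hzero.mono_right nhdsWithin_le_nhds)
          (hah.mono_right nhdsWithin_le_nhds) ?_ ?_
        · filter_upwards [eventually_gt_atTop (g (δ / 2))] with Λ hΛ using (hx Λ hΛ).1
        · filter_upwards [eventually_gt_atTop (g (δ / 2))] with Λ hΛ using (hx Λ hΛ).2.1
      · filter_upwards [eventually_gt_atTop (g (δ / 2))] with Λ hΛ
          using (hposh Λ hΛ).trans_le (hx Λ hΛ).1
    have hlim : Tendsto (fun Λ => U (x Λ) / g (x Λ) *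
        (g (h Λ) / g (a * h Λ) * (g (a * h Λ) / U (a * h Λ)))) atTop (𝓝 (c * (a ^ α * c⁻¹))) :=
      (hUg.comp hx0).mul ((hg_ratio a ha0).mul (hgU.comp hah))
    rw [show c * (a ^ α * c⁻¹) = a ^ α by field_simp] at hlim
    filter_upwards [hlim.eventually (gt_mem_nhds hab), hgh, hx0.eventually hgpos',
      hah.eventually hgpos', hah.eventually hU.pos, eventually_gt_atTop (g (δ / 2)),
      hx0.eventually self_mem_nhdsWithin, hah.eventually self_mem_nhdsWithin]
      with Λ h1 h2 h3 h4 h5 h6 h7 h8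
    refine lt_of_le_of_lt ?_ h1
    calc g (h Λ) / Λ ≤ g (h Λ) / g (x Λ) := div_le_div_of_nonneg_left h2.le h3 (hx Λ h6).2.2.le
      _ = U (a * h Λ) / g (x Λ) * (g (h Λ) / U (a * h Λ)) := by field_simp
      _ ≤ U (x Λ) / g (x Λ) * (g (h Λ) / U (a * h Λ)) := by
          refine mul_le_mul_of_nonneg_right (div_le_div_of_nonneg_right ?_ h3.le) (by positivity)
          exact hU.anti h7 h8 (hx Λ h6).2.1
      _ = _ := by field_simp

end IsRegularTail

/-! ### Tails and truncated second moments of a Lévy measure -/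

/-- The two-sided tail `x ↦ ν {|y| > x}`. -/
def levyTail (ν : Measure ℝ) (x : ℝ) : ℝ := ν.real {y | x < |y|}

/-- The truncated second moment `∫_{|y| ≤ x} y² ν(dy)`. -/
noncomputable def truncatedSecondMoment (ν : Measure ℝ) (x : ℝ) : ℝ :=
  ∫ y in {y | |y| ≤ x}, y ^ 2 ∂ν

theorem measurableSet_abs_gt (x : ℝ) : MeasurableSet {y : ℝ | x < |y|} :=
  measurableSet_lt measurable_const measurable_norm

theorem measurableSet_abs_le (x : ℝ) : MeasurableSet {y : ℝ | |y| ≤ x} :=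
  measurableSet_le measurable_norm measurable_const

namespace IsLevyMeasure

variable {ν : Measure ℝ}

theorem integrable_min (hν : IsLevyMeasure ν) : Integrable (fun y : ℝ => min 1 (y ^ 2)) ν := by
  have hm : Measurable (fun y : ℝ => min 1 (y ^ 2)) := by fun_prop
  refine ⟨hm.aestronglyMeasurable, ?_⟩
  rw [hasFiniteIntegral_iff_ofReal (Eventually.of_forall fun y => by positivity)]
  exact hν.lintegral_lt_top

theorem measure_abs_gt_lt_top (hν : IsLevyMeasure ν) {x : ℝ} (hx : 0 < x) :
    ν {y | x < |y|} < ∞ := by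
  refine lt_of_le_of_lt (measure_mono fun y hy => ?_)
    (hν.integrable_min.measure_ge_lt_top (ε := min 1 (x ^ 2)) (by positivity))
  have hy' : x < |y| := hy
  change min 1 (x ^ 2) ≤ min 1 (y ^ 2)
  rw [← sq_abs y]
  exact min_le_min le_rfl (pow_le_pow_left₀ hx.le hy'.le 2)

theorem integrableOn_sq (hν : IsLevyMeasure ν) {x : ℝ} (hx : x ≤ 1) :
    IntegrableOn (fun y : ℝ => y ^ 2) {y | |y| ≤ x} ν := by
  refine (hν.integrable_min.integrableOn (s := {y | |y| ≤ x})).congr_fun (fun y hy => ?_)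
    (measurableSet_abs_le x)
  exact min_eq_right ((sq_le_one_iff_abs_le_one y).2 (le_trans hy hx))

theorem levyTail_antitoneOn (hν : IsLevyMeasure ν) : AntitoneOn (levyTail ν) (Ioi 0) := by
  intro x hx y _ hxy
  exact measureReal_mono (fun z hz => lt_of_le_of_lt hxy hz) (hν.measure_abs_gt_lt_top hx).ne

theorem levyTail_eq (hν : IsLevyMeasure ν) {x : ℝ} (hx : 0 < x) :
    levyTail ν x = ν.real (Ioi x) + ν.real (Iio (-x)) := by
  have hset : {y : ℝ | x < |y|} = Ioi x ∪ Iio (-x) := by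
    ext y
    simp only [mem_ofPred_eq, mem_union, mem_Ioi, mem_Iio, lt_abs, lt_neg]
  have hfin := (hν.measure_abs_gt_lt_top hx).ne
  rw [levyTail, hset]
  rw [hset] at hfin
  refine measureReal_union ?_ measurableSet_Iio
    (measure_ne_top_of_subset subset_union_left hfin)
    (measure_ne_top_of_subset subset_union_right hfin)
  exact Set.disjoint_left.2 fun y (h1 : x < y) (h2 : y < -x) => by linarith

theorem tendsto_levyTail_div (hν : IsLevyMeasure ν) {α : ℝ} {g : ℝ → ℝ} {cp cm : ℝ}
    (hR : RegularVariationAssumption ν α g cp cm) :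
    Tendsto (fun x => levyTail ν x / g x) (𝓝[>] 0) (𝓝 (cp + cm)) := by
  refine (hR.tendsto_right.add hR.tendsto_left).congr' ?_
  filter_upwards [self_mem_nhdsWithin] with x hx
  rw [hν.levyTail_eq hx, add_div]

theorem isRegularTail_levyTail (hν : IsLevyMeasure ν) {α : ℝ} {g : ℝ → ℝ} {cp cm : ℝ}
    (hR : RegularVariationAssumption ν α g cp cm) : IsRegularTail (levyTail ν) α := by
  obtain ⟨δ, hδ, hgpos, -⟩ := hR.regularlyVarying.pos_measurable
  have hgpos' : ∀ᶠ x in 𝓝[>] (0 : ℝ), 0 < g x := by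
    filter_upwards [Ioo_mem_nhdsGT hδ] with x hx using hgpos x hx
  have hT := hν.tendsto_levyTail_div hR
  have hpos : ∀ᶠ x in 𝓝[>] (0 : ℝ), 0 < levyTail ν x := by
    filter_upwards [hgpos', hT.eventually (lt_mem_nhds hR.sum_pos)] with x h1 h2
    exact (div_pos_iff_of_pos_right h1).1 h2
  refine ⟨hν.levyTail_antitoneOn, hpos, fun l hl => ?_⟩
  have hl0 := tendsto_const_mul_nhdsGT_zero hl
  have h := ((hT.comp hl0).mul (hR.regularlyVarying.tendsto_ratio l hl)).div hT hR.sum_pos.ne'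
  rw [mul_div_cancel_left₀ _ hR.sum_pos.ne'] at h
  refine h.congr' ?_
  filter_upwards [hgpos', hl0.eventually hgpos', hpos] with x h1 h2 h3
  simp only [Function.comp, Pi.div_apply]
  field_simp

/-- On a side of the origin that carries a positive share of the tail (side `+` for `σ = 1`, side
`-` for `σ = -1`), every shell `(a x, b x]` carries a positive share of `ν {|y| > x}` as `x ↓ 0`. -/
theorem exists_side_shell (hν : IsLevyMeasure ν) {α : ℝ} {g : ℝ → ℝ} {cp cm : ℝ}
    (hR : RegularVariationAssumption ν α g cp cm) :
    ∃ σ : ℝ, |σ| = 1 ∧ ∀ a b : ℝ, 0 < a → a < b → ∃ κ : ℝ, 0 < κ ∧ ∀ᶠ x in 𝓝[>] (0 : ℝ),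
      κ * levyTail ν x ≤ ν.real {y | a * x < σ * y ∧ σ * y ≤ b * x} := by
  obtain ⟨δ, hδ, hgpos, -⟩ := hR.regularlyVarying.pos_measurable
  have hgpos' : ∀ᶠ x in 𝓝[>] (0 : ℝ), 0 < g x := by
    filter_upwards [Ioo_mem_nhdsGT hδ] with x hx using hgpos x hx
  have hα := hR.alpha_mem.1
  obtain ⟨σ, hσ, cσ, hcσ, hlim⟩ : ∃ σ : ℝ, |σ| = 1 ∧ ∃ cσ : ℝ, 0 < cσ ∧
      Tendsto (fun x => ν.real {y | x < σ * y} / g x) (𝓝[>] 0) (𝓝 cσ) := by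
    rcases hR.cp_nonneg.eq_or_lt with h | h
    · refine ⟨-1, by simp, cm, by linarith [hR.sum_pos], hR.tendsto_left.congr fun x => ?_⟩
      congr 2
      ext y
      simp [lt_neg]
    · refine ⟨1, by simp, cp, h, hR.tendsto_right.congr fun x => ?_⟩
      congr 2
      ext y
      simp
  refine ⟨σ, hσ, fun a b ha hab => ?_⟩
  have hb : 0 < b := ha.trans hab
  have hlt : b ^ (-α) < a ^ (-α) := Real.rpow_lt_rpow_of_neg ha hab (by linarith)
  have hscale : ∀ l : ℝ, 0 < l →
      Tendsto (fun x => ν.real {y | l * x < σ * y} / g x) (𝓝[>] 0) (𝓝 (cσ * l ^ (-α))) := by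
    intro l hl
    have hl0 := tendsto_const_mul_nhdsGT_zero hl
    refine ((hlim.comp hl0).mul (hR.regularlyVarying.tendsto_ratio l hl)).congr' ?_
    filter_upwards [hgpos', hl0.eventually hgpos'] with x h1 h2
    simp only [Function.comp]
    field_simp
  have hT := hν.tendsto_levyTail_div hR
  have hκ : 0 < (cσ * a ^ (-α) - cσ * b ^ (-α)) / (cp + cm) :=
    div_pos (by nlinarith) hR.sum_pos
  have hfinal := ((hscale a ha).sub (hscale b hb)).div hT hR.sum_pos.ne'
  refine ⟨_, half_pos hκ, ?_⟩
  filter_upwards [hfinal.eventually (lt_mem_nhds (half_lt_self hκ)), hgpos', self_mem_nhdsWithin,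
    (hν.isRegularTail_levyTail hR).pos] with x h1 h2 h3 h4
  have hx : 0 < x := h3
  have hsub : {y | b * x < σ * y} ⊆ {y | a * x < σ * y} := fun y hy =>
    lt_of_le_of_lt (mul_le_mul_of_nonneg_right hab.le hx.le) hy
  have hfin : ν {y | a * x < σ * y} ≠ ∞ := by
    refine measure_ne_top_of_subset (s := {y | a * x < |y|}) (fun y hy => ?_)
      (hν.measure_abs_gt_lt_top (mul_pos ha hx)).ne
    calc a * x < σ * y := hy
      _ ≤ |σ * y| := le_abs_self _
      _ = |y| := by rw [abs_mul, hσ, one_mul]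
  have hmeas : MeasurableSet {y | b * x < σ * y} :=
    measurableSet_lt measurable_const (measurable_const_mul σ)
  have hset : {y | a * x < σ * y ∧ σ * y ≤ b * x}
      = {y | a * x < σ * y} \ {y | b * x < σ * y} := by
    ext y
    simp
  rw [hset, measureReal_sdiff hsub hmeas hfin]
  simp only [Pi.div_apply] at h1
  rw [← sub_div, div_div_div_cancel_right₀ h2.ne', lt_div_iff₀ h4] at h1
  exact h1.le

theorem truncatedSecondMoment_halving (hν : IsLevyMeasure ν) {x : ℝ} (hx : 0 < x) (hx1 : x ≤ 1) :
    truncatedSecondMoment ν x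
      ≤ truncatedSecondMoment ν (x / 2) + x ^ 2 * levyTail ν (x / 2) := by
  have hfin := (hν.measure_abs_gt_lt_top (half_pos hx))
  have hset : {y : ℝ | |y| ≤ x} = {y | |y| ≤ x / 2} ∪ {y | x / 2 < |y| ∧ |y| ≤ x} := by
    ext y
    simp only [mem_ofPred_eq, mem_union]
    constructor
    · intro h
      rcases le_or_gt |y| (x / 2) with h' | h'
      · exact Or.inl h'
      · exact Or.inr ⟨h', h⟩
    · rintro (h | h)
      · linarith
      · exact h.2
  have hmeas : MeasurableSet {y : ℝ | x / 2 < |y| ∧ |y| ≤ x} :=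
    (measurableSet_abs_gt _).inter (measurableSet_abs_le _)
  have hint := hν.integrableOn_sq hx1
  have hsub2 : {y : ℝ | x / 2 < |y| ∧ |y| ≤ x} ⊆ {y | |y| ≤ x} := fun y hy => hy.2
  rw [truncatedSecondMoment, hset, setIntegral_union ?_ hmeas
    (hν.integrableOn_sq (by linarith)) (hint.mono_set hsub2)]
  · refine add_le_add le_rfl ?_
    have hfin2 : ν {y : ℝ | x / 2 < |y| ∧ |y| ≤ x} ≠ ∞ :=
      measure_ne_top_of_subset (fun y hy => hy.1) hfin.ne
    calc ∫ y in {y | x / 2 < |y| ∧ |y| ≤ x}, y ^ 2 ∂ν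
        ≤ ∫ y in {y | x / 2 < |y| ∧ |y| ≤ x}, x ^ 2 ∂ν := by
          refine setIntegral_mono_on (hint.mono_set hsub2) (integrableOn_const hfin2) hmeas ?_
          intro y hy
          rw [← sq_abs y]
          exact pow_le_pow_left₀ (abs_nonneg y) hy.2 2
      _ = x ^ 2 * ν.real {y | x / 2 < |y| ∧ |y| ≤ x} := by
          rw [setIntegral_const, smul_eq_mul, mul_comm]
      _ ≤ x ^ 2 * levyTail ν (x / 2) :=
          mul_le_mul_of_nonneg_left (measureReal_mono (fun y hy => hy.1) hfin.ne) (by positivity)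
  · exact Set.disjoint_left.2 fun y h1 h2 => not_le.2 h2.1 h1

theorem tendsto_truncatedSecondMoment (hν : IsLevyMeasure ν) {x : ℝ} (hx : 0 < x) (hx1 : x ≤ 1) :
    Tendsto (fun m : ℕ => truncatedSecondMoment ν (x / 2 ^ m)) atTop (𝓝 0) := by
  have hanti : Antitone fun m : ℕ => {y : ℝ | |y| ≤ x / 2 ^ m} := by
    intro m k hmk y hy
    refine le_trans hy (div_le_div_of_nonneg_left hx.le (by positivity) ?_)
    exact pow_le_pow_right₀ (by norm_num) hmk
  have h := tendsto_setIntegral_of_antitone (μ := ν) (f := fun y : ℝ => y ^ 2)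
    (fun m : ℕ => measurableSet_abs_le (x / 2 ^ m)) hanti
    ⟨0, by simpa using hν.integrableOn_sq hx1⟩
  have hzero : ∫ y in ⋂ m : ℕ, {y : ℝ | |y| ≤ x / 2 ^ m}, y ^ 2 ∂ν = 0 := by
    refine setIntegral_eq_zero_of_forall_eq_zero fun y hy => ?_
    have hlim : Tendsto (fun m : ℕ => x / 2 ^ m) atTop (𝓝 0) :=
      tendsto_const_nhds.div_atTop (tendsto_pow_atTop_atTop_of_one_lt one_lt_two)
    have : |y| ≤ 0 := ge_of_tendsto' hlim fun m => mem_iInter.1 hy m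
    rw [abs_nonpos_iff.1 this]
    norm_num
  rwa [hzero] at h

/-- Karamata's bound for the truncated second moment. The shells `x / 2 ^ (j + 1) < |y| ≤ x / 2 ^ j`
contribute a geometric series of ratio `B / 4`, where `B ∈ (2 ^ α, 4)`. -/
theorem exists_truncatedSecondMoment_le (hν : IsLevyMeasure ν) {α : ℝ}
    (hU : IsRegularTail (levyTail ν) α) (hα : α < 2) :
    ∃ K : ℝ, 0 < K ∧ ∃ q : ℝ, 0 ≤ q ∧ q < 1 ∧ ∀ᶠ x in 𝓝[>] (0 : ℝ), ∀ m : ℕ,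
      truncatedSecondMoment ν (x / 2 ^ m) ≤ K * q ^ m * (x ^ 2 * levyTail ν x) := by
  have h4 : (2 : ℝ) ^ α < 4 := by
    calc (2 : ℝ) ^ α < 2 ^ (2 : ℝ) := Real.rpow_lt_rpow_of_exponent_lt (by norm_num) hα
      _ = 4 := by norm_num
  obtain ⟨B, hB, hB4⟩ := exists_between h4
  have hB0 : 0 < B := lt_trans (by positivity) hB
  obtain ⟨x₁, hx₁, h⟩ := eventually_nhdsGT_zero_iff.1 (hU.eventually_halving hB)
  set K : ℝ := B / (1 - B / 4) with hK
  have hK0 : 0 < K := div_pos hB0 (by linarith)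
  have hKeq : (K / 4 + 1) * B = K := by
    have : K * (1 - B / 4) = B := div_mul_cancel₀ _ (by linarith)
    linarith
  have hiter : ∀ m : ℕ, ∀ x, 0 < x → x ≤ min x₁ 1 →
      truncatedSecondMoment ν x
        ≤ truncatedSecondMoment ν (x / 2 ^ m) + K * (x ^ 2 * levyTail ν x) := by
    intro m
    induction m with
    | zero =>
      intro x hx hx1
      have := (h x hx (hx1.trans (min_le_left _ _))).1
      simp only [pow_zero, div_one, le_add_iff_nonneg_right]
      positivity
    | succ m ih =>
      intro x hx hx1
      have h1 := hν.truncatedSecondMoment_halving hx (hx1.trans (min_le_right _ _))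
      have h2 := ih (x / 2) (half_pos hx) (by linarith)
      have h3 := (h x hx (hx1.trans (min_le_left _ _))).2
      rw [div_div, ← pow_succ'] at h2
      have h4 : x ^ 2 * levyTail ν (x / 2) ≤ x ^ 2 * (B * levyTail ν x) :=
        mul_le_mul_of_nonneg_left h3 (by positivity)
      calc truncatedSecondMoment ν x
          ≤ truncatedSecondMoment ν (x / 2 ^ (m + 1))
            + (K / 4 + 1) * (x ^ 2 * levyTail ν (x / 2)) := by linarith
        _ ≤ truncatedSecondMoment ν (x / 2 ^ (m + 1))
            + (K / 4 + 1) * (x ^ 2 * (B * levyTail ν x)) := by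
          refine add_le_add le_rfl (mul_le_mul_of_nonneg_left h4 (by linarith))
        _ = truncatedSecondMoment ν (x / 2 ^ (m + 1))
            + ((K / 4 + 1) * B) * (x ^ 2 * levyTail ν x) := by ring
        _ = _ := by rw [hKeq]
  have hbound : ∀ x, 0 < x → x ≤ min x₁ 1 →
      truncatedSecondMoment ν x ≤ K * (x ^ 2 * levyTail ν x) := by
    intro x hx hx1
    have hlim := (hν.tendsto_truncatedSecondMoment hx (hx1.trans (min_le_right _ _))).add_const
      (K * (x ^ 2 * levyTail ν x))
    rw [zero_add] at hlim
    exact ge_of_tendsto' hlim fun m => hiter m x hx hx1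
  refine ⟨K, hK0, B / 4, by positivity, by linarith,
    eventually_nhdsGT_zero_iff.2 ⟨min x₁ 1, by positivity, fun x hx hx1 m => ?_⟩⟩
  have hp : (1 : ℝ) ≤ 2 ^ m := one_le_pow₀ (by norm_num)
  have h1 := hbound (x / 2 ^ m) (by positivity) ((div_le_self hx.le hp).trans hx1)
  have h2 := IsRegularTail.le_pow_mul_of_halving hB0.le (fun y h0 h1 => (h y h0 h1).2) m hx
    (hx1.trans (min_le_left _ _))
  calc truncatedSecondMoment ν (x / 2 ^ m)
      ≤ K * ((x / 2 ^ m) ^ 2 * levyTail ν (x / 2 ^ m)) := h1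
    _ ≤ K * ((x / 2 ^ m) ^ 2 * (B ^ m * levyTail ν x)) := by gcongr
    _ = K * (B / 4) ^ m * (x ^ 2 * levyTail ν x) := by
        have : (4 : ℝ) ^ m = (2 ^ m) ^ 2 := by
          rw [← pow_mul, mul_comm, pow_mul]
          norm_num
        rw [div_pow, div_pow, this]
        field_simp

end IsLevyMeasure

/-! ### Convex hulls of compact sets in finite dimension -/

/-- By Carathéodory's theorem the convex hull is the continuous image of the product of a standard
simplex and a power of the set. -/
theorem IsCompact.convexHull_of_finiteDimensional {E : Type*} [NormedAddCommGroup E]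
    [NormedSpace ℝ E] [FiniteDimensional ℝ E] {s : Set E} (hs : IsCompact s) :
    IsCompact (convexHull ℝ s) := by
  rcases s.eq_empty_or_nonempty with rfl | ⟨z₀, hz₀⟩
  · simp
  set N := Module.finrank ℝ E + 1
  have hcomp : IsCompact (stdSimplex ℝ (Fin N) ×ˢ univ.pi fun _ : Fin N => s) :=
    (isCompact_stdSimplex ℝ (Fin N)).prod (isCompact_univ_pi fun _ => hs)
  have hcont : Continuous fun p : (Fin N → ℝ) × (Fin N → E) => ∑ i, p.1 i • p.2 i := by fun_prop
  convert hcomp.image hcont using 1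
  refine Subset.antisymm (fun x hx => ?_) ?_
  · obtain ⟨ι, _, z, w, hz, hind, hw, hw1, hwx⟩ := eq_pos_convex_span_of_mem_convexHull hx
    have hcard : Fintype.card ι ≤ Fintype.card (Fin N) := by
      rw [Fintype.card_fin]
      exact hind.card_le_finrank_succ.trans
        (Nat.succ_le_succ (Submodule.finrank_le _))
    obtain ⟨e⟩ := Function.Embedding.nonempty_of_card_le hcard
    have hout : ∀ i, i ∉ range e → Function.extend e w 0 i = 0 := fun i hi =>
      Function.extend_apply' _ _ _ hi
    refine ⟨(Function.extend e w 0, Function.extend e z fun _ => z₀), ⟨⟨fun i => ?_, ?_⟩,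
      fun i _ => ?_⟩, ?_⟩
    · by_cases hi : i ∈ range e
      · obtain ⟨j, rfl⟩ := hi
        simp only [e.injective.extend_apply]
        exact (hw j).le
      · exact (hout i hi).ge
    · rw [← hw1]
      exact (Fintype.sum_of_injective e e.injective _ _ hout
        fun j => (e.injective.extend_apply _ _ _).symm).symm
    · by_cases hi : i ∈ range e
      · obtain ⟨j, rfl⟩ := hi
        simp only [e.injective.extend_apply]
        exact hz (mem_range_self j)
      · simp only [Function.extend_apply' _ _ _ hi]
        exact hz₀
    · rw [← hwx]
      refine (Fintype.sum_of_injective e e.injective _ _ (fun i hi => ?_) fun j => ?_).symm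
      · simp only [hout i hi, zero_smul]
      · simp only [e.injective.extend_apply]
  · rintro _ ⟨⟨w, z⟩, ⟨hw, hz⟩, rfl⟩
    exact (convex_convexHull ℝ s).sum_mem (fun i _ => hw.1 i) hw.2
      fun i _ => subset_convexHull ℝ s (hz i (mem_univ i))

/-! ### Polynomials that are nonnegative on an annulus -/

open Polynomial in
/-- A polynomial of degree less than `d` is controlled on `[-ε, ε]` by its values at `d` points that
are `s ε`-separated (Lagrange interpolation). -/
theorem Polynomial.abs_eval_le_of_separated {d : ℕ} {r : ℝ[X]} (hr : r.degree < d) {x : Fin d → ℝ}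
    {ε s : ℝ} (hε : 0 < ε) (hs : 0 < s) (hs2 : s ≤ 2) (hx : ∀ i, |x i| ≤ ε)
    (hsep : ∀ i j, i ≠ j → s * ε ≤ |x i - x j|) {y : ℝ} (hy : |y| ≤ ε) :
    |r.eval y| ≤ (2 / s) ^ d * ∑ i, |r.eval (x i)| := by
  have hsε : 0 < s * ε := mul_pos hs hε
  have hinj : Set.InjOn x (Finset.univ : Finset (Fin d)) := by
    intro i _ j _ hij
    by_contra hne
    have := hsep i j hne
    rw [hij, sub_self, abs_zero] at this
    linarith
  have h1s : 1 ≤ 2 / s := (one_le_div hs).2 hs2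
  have hbasis : ∀ i, |(Lagrange.basis Finset.univ x i).eval y| ≤ (2 / s) ^ d := by
    intro i
    rw [Lagrange.basis, eval_prod, Finset.abs_prod]
    calc ∏ j ∈ Finset.univ.erase i, |(Lagrange.basisDivisor (x i) (x j)).eval y|
        ≤ ∏ j ∈ Finset.univ.erase i, (2 / s) := by
          refine Finset.prod_le_prod (fun _ _ => abs_nonneg _) fun j hj => ?_
          have hne : i ≠ j := (Finset.ne_of_mem_erase hj).symm
          have h1 := hsep i j hne
          have h2 : |y - x j| ≤ 2 * ε := (abs_sub _ _).trans (by linarith [hx j])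
          rw [Lagrange.basisDivisor, eval_mul, eval_C, eval_sub, eval_X, eval_C, abs_mul, abs_inv,
            inv_mul_eq_div]
          calc |y - x j| / |x i - x j| ≤ (2 * ε) / (s * ε) := by gcongr
            _ = 2 / s := by field_simp
      _ = (2 / s) ^ (Finset.univ.erase i).card := by rw [Finset.prod_const]
      _ ≤ (2 / s) ^ d := by
          refine pow_le_pow_right₀ h1s ((Finset.card_le_univ _).trans_eq (Fintype.card_fin d))
  have hdeg : r.degree < (Finset.univ : Finset (Fin d)).card := by simpa using hr
  have hr' := Lagrange.eq_interpolate hinj hdeg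
  calc |r.eval y|
      = |∑ i, r.eval (x i) * (Lagrange.basis Finset.univ x i).eval y| := by
        conv_lhs => rw [hr', Lagrange.interpolate_apply, eval_finsetSum]
        simp only [eval_mul, eval_C]
    _ ≤ ∑ i, |r.eval (x i)| * |(Lagrange.basis Finset.univ x i).eval y| := by
        refine (Finset.abs_sum_le_sum_abs _ _).trans_eq ?_
        simp only [abs_mul]
    _ ≤ ∑ i, |r.eval (x i)| * (2 / s) ^ d :=
        Finset.sum_le_sum fun i _ => mul_le_mul_of_nonneg_left (hbasis i) (abs_nonneg _)
    _ = _ := by rw [← Finset.sum_mul, mul_comm]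

open Polynomial in
/-- A polynomial `r` of degree less than `d` that is nonnegative for `η ≤ |y| ≤ ε` has a nonnegative
integral against `y² ν(dy)` over `|y| ≤ ε`, provided that `d` separated shells carry enough mass
compared with the second moment of `ν` over `|y| ≤ η`. Indeed, with `x i` a minimum point of `r` on
the `i`-th shell, both the gain on the shells and the loss on `|y| ≤ η` are multiples
of `∑ i, r (x i)`. -/
theorem setIntegral_eval_mul_sq_nonneg {d : ℕ} {r : ℝ[X]} (hr : r.degree < d) {ν : Measure ℝ}
    {ε η s M σ : ℝ} (hη : 0 < η) (hηε : η < ε / 2) (hs : 0 < s) (hs2 : s ≤ 2) (hσ : |σ| = 1)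
    (hint : IntegrableOn (fun y : ℝ => y ^ 2) {y | |y| ≤ ε} ν)
    (hfin : ν {y | η < |y|} < ∞)
    {a b : Fin d → ℝ} (ha : ∀ i, 1 / 2 ≤ a i) (hab : ∀ i, a i ≤ b i) (hb : ∀ i, b i ≤ 1)
    (hsep : ∀ i j, i < j → b i + s ≤ a j)
    (hM : ∀ i, M ≤ ν.real {y | a i * ε < σ * y ∧ σ * y ≤ b i * ε})
    (hN : (2 / s) ^ d * truncatedSecondMoment ν η ≤ ε ^ 2 / 4 * M)
    (hr0 : ∀ y, η ≤ |y| → |y| ≤ ε → 0 ≤ r.eval y) :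
    0 ≤ ∫ y in {y | |y| ≤ ε}, r.eval y * y ^ 2 ∂ν := by
  have hε : 0 < ε := by linarith
  have hσσ : σ * σ = 1 := by rw [← abs_mul_abs_self, hσ, one_mul]
  have habs : ∀ t, |σ * t| = |t| := fun t => by rw [abs_mul, hσ, one_mul]
  have hmin : ∀ i, ∃ t ∈ Icc (a i * ε) (b i * ε), ∀ u ∈ Icc (a i * ε) (b i * ε),
      r.eval (σ * t) ≤ r.eval (σ * u) := fun i =>
    isCompact_Icc.exists_isMinOn (nonempty_Icc.2 (mul_le_mul_of_nonneg_right (hab i) hε.le))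
      (by fun_prop : ContinuousOn (fun u => r.eval (σ * u)) _)
  choose t ht htmin using hmin
  have htpos : ∀ i u, u ∈ Icc (a i * ε) (b i * ε) → ε / 2 ≤ u ∧ u ≤ ε := fun i u hu =>
    ⟨by nlinarith [hu.1, ha i], by nlinarith [hu.2, hb i]⟩
  have hshell : ∀ i u, u ∈ Icc (a i * ε) (b i * ε) → η < |u| ∧ ε / 2 ≤ |u| ∧ |u| ≤ ε := by
    intro i u hu
    obtain ⟨h1, h2⟩ := htpos i u hu
    rw [abs_of_pos (by linarith)]
    exact ⟨by linarith, h1, h2⟩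
  have hrt : ∀ i, 0 ≤ r.eval (σ * t i) := fun i => by
    obtain ⟨h1, h2, h3⟩ := hshell i (t i) (ht i)
    exact hr0 _ (by rw [habs]; exact h1.le) (by rwa [habs])
  set R := ∑ i, r.eval (σ * t i) with hR
  have hR0 : 0 ≤ R := Finset.sum_nonneg fun i _ => hrt i
  have hsep' : ∀ i j, i < j → s * ε ≤ t j - t i := fun i j hij => by
    nlinarith [(ht i).2, (ht j).1, hsep i j hij]
  have hbound : ∀ y, |y| ≤ ε → |r.eval y| ≤ (2 / s) ^ d * R := by
    intro y hy
    have h := Polynomial.abs_eval_le_of_separated hr (x := fun i => σ * t i) hε hs hs2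
      (fun i => by rw [habs]; exact (hshell i _ (ht i)).2.2) (fun i j hij => ?_) hy
    · simpa only [abs_of_nonneg (hrt _), ← hR] using h
    · rw [← mul_sub, habs]
      rcases lt_or_gt_of_ne hij with hlt | hlt
      · rw [abs_sub_comm]
        exact (hsep' i j hlt).trans (le_abs_self _)
      · exact (hsep' j i hlt).trans (le_abs_self _)
  set P := (2 / s) ^ d * R with hP
  have hP0 : 0 ≤ P := by positivity
  have hf : IntegrableOn (fun y => r.eval y * y ^ 2) {y | |y| ≤ ε} ν := by
    refine Integrable.mono' (hint.const_mul P) (by fun_prop) ?_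
    refine (ae_restrict_iff' (measurableSet_abs_le ε)).2 (Eventually.of_forall fun y hy => ?_)
    rw [Real.norm_eq_abs, abs_mul, abs_of_nonneg (sq_nonneg y)]
    exact mul_le_mul_of_nonneg_right (hbound y hy) (sq_nonneg y)
  have hsub1 : {y : ℝ | |y| ≤ η} ⊆ {y | |y| ≤ ε} := fun y (hy : |y| ≤ η) =>
    show |y| ≤ ε by linarith
  have hsub2 : {y : ℝ | |y| ≤ ε} \ {y | |y| ≤ η} ⊆ {y | |y| ≤ ε} := sdiff_subset
  have hsplit := integral_inter_add_sdiff (μ := ν) (measurableSet_abs_le η) hf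
  rw [inter_eq_self_of_subset_right hsub1] at hsplit
  have hin : -(P * truncatedSecondMoment ν η) ≤ ∫ y in {y | |y| ≤ η}, r.eval y * y ^ 2 ∂ν := by
    rw [truncatedSecondMoment, ← neg_mul, ← integral_const_mul]
    refine setIntegral_mono_on ((hint.mono_set hsub1).const_mul _) (hf.mono_set hsub1)
      (measurableSet_abs_le η) fun y hy => ?_
    exact mul_le_mul_of_nonneg_right (neg_le_of_abs_le (hbound y (hsub1 hy))) (sq_nonneg y)
  let J : Fin d → Set ℝ := fun i => {y | a i * ε < σ * y ∧ σ * y ≤ b i * ε}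
  have hJmeas : ∀ i, MeasurableSet (J i) := fun i =>
    (measurableSet_lt measurable_const (measurable_const_mul σ)).inter
      (measurableSet_le (measurable_const_mul σ) measurable_const)
  have hJmem : ∀ i y, y ∈ J i → σ * y ∈ Icc (a i * ε) (b i * ε) := fun i y hy =>
    ⟨hy.1.le, hy.2⟩
  have hJabs : ∀ i y, y ∈ J i → η < |y| ∧ ε / 2 ≤ |y| ∧ |y| ≤ ε := fun i y hy => by
    simpa only [habs] using hshell i _ (hJmem i y hy)
  have hJsub : (⋃ i, J i) ⊆ {y | |y| ≤ ε} \ {y | |y| ≤ η} := by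
    refine iUnion_subset fun i y hy => ?_
    obtain ⟨h1, -, h3⟩ := hJabs i y hy
    exact ⟨h3, not_le.2 h1⟩
  have hJdisj : Pairwise (Function.onFun Disjoint J) := by
    have key : ∀ i j, i < j → Disjoint (J i) (J j) := fun i j hij =>
      Set.disjoint_left.2 fun y hi hj => by
        nlinarith [hi.2, hj.1, hsep i j hij]
    intro i j hij
    rcases lt_or_gt_of_ne hij with hlt | hlt
    · exact key i j hlt
    · exact (key j i hlt).symm
  have hout : ε ^ 2 / 4 * M * R ≤ ∫ y in {y | |y| ≤ ε} \ {y | |y| ≤ η}, r.eval y * y ^ 2 ∂ν := by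
    calc ε ^ 2 / 4 * M * R = ∑ i, ε ^ 2 / 4 * r.eval (σ * t i) * M := by
          rw [hR, Finset.mul_sum]
          exact Finset.sum_congr rfl fun i _ => by ring
      _ ≤ ∑ i, ∫ y in J i, r.eval y * y ^ 2 ∂ν := by
          refine Finset.sum_le_sum fun i _ => ?_
          have hJfin : ν (J i) ≠ ∞ :=
            measure_ne_top_of_subset (fun y hy => (hJabs i y hy).1) hfin.ne
          calc ε ^ 2 / 4 * r.eval (σ * t i) * M
              ≤ ε ^ 2 / 4 * r.eval (σ * t i) * ν.real (J i) :=
                mul_le_mul_of_nonneg_left (hM i) (mul_nonneg (by positivity) (hrt i))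
            _ = ∫ y in J i, ε ^ 2 / 4 * r.eval (σ * t i) ∂ν := by
                rw [setIntegral_const, smul_eq_mul, mul_comm]
            _ ≤ ∫ y in J i, r.eval y * y ^ 2 ∂ν := by
                refine setIntegral_mono_on (integrableOn_const hJfin)
                  (hf.mono_set fun y hy => (hJabs i y hy).2.2) (hJmeas i) fun y hy => ?_
                have h1 := htmin i _ (hJmem i y hy)
                rw [← mul_assoc, hσσ, one_mul] at h1
                have h2 : ε ^ 2 / 4 ≤ y ^ 2 := by
                  rw [← sq_abs y, show ε ^ 2 / 4 = (ε / 2) ^ 2 by ring]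
                  exact pow_le_pow_left₀ (by positivity) (hJabs i y hy).2.1 2
                rw [mul_comm]
                exact mul_le_mul h1 h2 (by positivity) ((hrt i).trans h1)
      _ = ∫ y in ⋃ i, J i, r.eval y * y ^ 2 ∂ν :=
          (integral_iUnion_fintype hJmeas hJdisj
            fun i => hf.mono_set fun y hy => (hJabs i y hy).2.2).symm
      _ ≤ _ := by
          refine setIntegral_mono_set (hf.mono_set hsub2) ?_ (LE.le.eventuallyLE hJsub)
          refine (ae_restrict_iff' (MeasurableSet.diff (measurableSet_abs_le ε) (measurableSet_abs_le η))).2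
            (Eventually.of_forall fun y hy => ?_)
          exact mul_nonneg (hr0 y (not_le.1 hy.2).le hy.1) (sq_nonneg y)
  rw [← hsplit]
  have hfinal : P * truncatedSecondMoment ν η ≤ ε ^ 2 / 4 * M * R := by
    rw [hP]
    nlinarith
  linarith

/-! ### Atomic measures with prescribed moments -/

section Matching

variable {ν : Measure ℝ} {ε : ℝ}

theorem integrableOn_pow_add_two (hint : IntegrableOn (fun y : ℝ => y ^ 2) {y | |y| ≤ ε} ν)
    (k : ℕ) : IntegrableOn (fun y : ℝ => y ^ (k + 2)) {y | |y| ≤ ε} ν := by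
  refine Integrable.mono' (hint.const_mul (ε ^ k)) (by fun_prop) ?_
  refine (ae_restrict_iff' (measurableSet_abs_le ε)).2 (Eventually.of_forall fun y hy => ?_)
  rw [Real.norm_eq_abs, pow_add, abs_mul, abs_of_nonneg (sq_nonneg y), abs_pow]
  exact mul_le_mul_of_nonneg_right (pow_le_pow_left₀ (abs_nonneg y) hy k) (sq_nonneg y)

theorem abs_setIntegral_pow_add_two_le
    (hint : IntegrableOn (fun y : ℝ => y ^ 2) {y | |y| ≤ ε} ν) (k : ℕ) :
    |∫ y in {y | |y| ≤ ε}, y ^ (k + 2) ∂ν| ≤ ε ^ k * truncatedSecondMoment ν ε := by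
  rw [truncatedSecondMoment, ← integral_const_mul, ← Real.norm_eq_abs]
  refine norm_integral_le_of_norm_le (hint.const_mul _) ?_
  refine (ae_restrict_iff' (measurableSet_abs_le ε)).2 (Eventually.of_forall fun y hy => ?_)
  rw [Real.norm_eq_abs, pow_add, abs_mul, abs_of_nonneg (sq_nonneg y), abs_pow]
  exact mul_le_mul_of_nonneg_right (pow_le_pow_left₀ (abs_nonneg y) hy k) (sq_nonneg y)

open Polynomial in
/-- If the truncated measure `y² 1_{|y| ≤ ε} ν(dy)` integrates every polynomial of degree less
than `d` that is nonnegative on the annulus `η ≤ |y| ≤ ε` to a nonnegative number, then its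
normalized moment vector lies in the convex hull of the moment curve over the annulus: otherwise a
separating hyperplane is a polynomial that contradicts the hypothesis. -/
theorem moments_mem_convexHull {d : ℕ} {η : ℝ} (hd : 0 < d)
    (hint : IntegrableOn (fun y : ℝ => y ^ 2) {y | |y| ≤ ε} ν)
    (hV : 0 < truncatedSecondMoment ν ε)
    (hpos : ∀ r : ℝ[X], r.degree < d → (∀ y, η ≤ |y| → |y| ≤ ε → 0 ≤ r.eval y) →
      0 ≤ ∫ y in {y | |y| ≤ ε}, r.eval y * y ^ 2 ∂ν) :
    (fun k : Fin d => (∫ y in {y | |y| ≤ ε}, y ^ ((k : ℕ) + 2) ∂ν) / truncatedSecondMoment ν ε) ∈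
      convexHull ℝ ((fun (y : ℝ) (k : Fin d) => y ^ (k : ℕ)) '' {y | η ≤ |y| ∧ |y| ≤ ε}) := by
  set V := truncatedSecondMoment ν ε with hVdef
  set w : Fin d → ℝ := fun k => (∫ y in {y | |y| ≤ ε}, y ^ ((k : ℕ) + 2) ∂ν) / V with hw
  set T : Set ℝ := {y | η ≤ |y| ∧ |y| ≤ ε} with hT
  have hTcomp : IsCompact T := by
    refine (isCompact_Icc (a := -ε) (b := ε)).of_isClosed_subset
      ((isClosed_le continuous_const continuous_abs).inter
        (isClosed_le continuous_abs continuous_const)) fun y hy => abs_le.1 hy.2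
  have hcurve : Continuous fun (y : ℝ) (k : Fin d) => y ^ (k : ℕ) := by fun_prop
  by_contra hnot
  obtain ⟨f, u, hlt, hgt⟩ := geometric_hahn_banach_closed_point (convex_convexHull ℝ _)
    (hTcomp.image hcurve).convexHull_of_finiteDimensional.isClosed hnot
  set e : Fin d → ℝ := fun k => f (Pi.single k 1) with he
  have hf : ∀ x : Fin d → ℝ, f x = ∑ k, e k * x k := by
    intro x
    conv_lhs => rw [← Finset.univ_sum_single x, map_sum]
    refine Finset.sum_congr rfl fun k _ => ?_
    have : Pi.single k (x k) = x k • (Pi.single k 1 : Fin d → ℝ) := by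
      rw [← Pi.single_smul, smul_eq_mul, mul_one]
    rw [this, map_smul, smul_eq_mul, mul_comm]
  set r : ℝ[X] := C u - ∑ k : Fin d, C (e k) * X ^ (k : ℕ) with hr
  have hreval : ∀ y, r.eval y = u - ∑ k : Fin d, e k * y ^ (k : ℕ) := by
    intro y
    simp [hr, eval_finsetSum]
  have hrdeg : r.degree < d := by
    rw [← mem_degreeLT]
    refine Submodule.sub_mem _ ?_ (Submodule.sum_mem _ fun k _ => ?_)
    · rw [mem_degreeLT]
      exact degree_C_le.trans_lt (by exact_mod_cast hd)
    · rw [mem_degreeLT]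
      exact (degree_C_mul_X_pow_le _ _).trans_lt (by exact_mod_cast k.isLt)
  have h := hpos r hrdeg fun y h1 h2 => by
    have := hlt _ (subset_convexHull ℝ _ (mem_image_of_mem _ (show y ∈ T from ⟨h1, h2⟩)))
    rw [hf] at this
    rw [hreval]
    linarith
  have hcalc : ∫ y in {y | |y| ≤ ε}, r.eval y * y ^ 2 ∂ν = u * V - V * f w := by
    have h1 : ∀ y : ℝ, r.eval y * y ^ 2 = u * y ^ 2 - ∑ k : Fin d, e k * y ^ ((k : ℕ) + 2) := by
      intro y
      rw [hreval, sub_mul, Finset.sum_mul]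
      congr 1
      exact Finset.sum_congr rfl fun k _ => by ring
    simp only [h1]
    have hi : ∀ k : Fin d, IntegrableOn (fun y => e k * y ^ ((k : ℕ) + 2)) {y | |y| ≤ ε} ν :=
      fun k => (integrableOn_pow_add_two hint k).const_mul _
    rw [integral_sub (hint.const_mul u) (integrable_finsetSum _ fun k _ => hi k),
      integral_const_mul, integral_finsetSum _ fun k _ => hi k, hf, Finset.mul_sum]
    congr 1
    refine Finset.sum_congr rfl fun k _ => ?_
    rw [integral_const_mul, hw]
    field_simp
  rw [hcalc] at h
  nlinarith

open Polynomial in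
/-- The moments of order `2, …, d + 1` of `ν` restricted to `|y| ≤ ε` are those of a finitely
supported measure on the annulus `η ≤ |y| ≤ ε`. As its atoms stay away from `0`, its mass is
controlled by its second moment, which is that of `ν` over `|y| ≤ ε`. -/
theorem exists_measure_moments_eq {d : ℕ} {η : ℝ} (hη : 0 < η) (hd : 0 < d)
    (hint : IntegrableOn (fun y : ℝ => y ^ 2) {y | |y| ≤ ε} ν)
    (hpos : ∀ r : ℝ[X], r.degree < d → (∀ y, η ≤ |y| → |y| ≤ ε → 0 ≤ r.eval y) →
      0 ≤ ∫ y in {y | |y| ≤ ε}, r.eval y * y ^ 2 ∂ν) :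
    ∃ μ : Measure ℝ, μ univ ≤ ENNReal.ofReal (truncatedSecondMoment ν ε / η ^ 2) ∧
      ∀ k < d, Integrable (fun y : ℝ => y ^ (k + 2)) μ ∧
        ∫ y, y ^ (k + 2) ∂μ = ∫ y in {y | |y| ≤ ε}, y ^ (k + 2) ∂ν := by
  have hV0 : 0 ≤ truncatedSecondMoment ν ε := integral_nonneg fun y => sq_nonneg y
  rcases hV0.eq_or_lt with hV | hV
  · refine ⟨0, by simp, fun k _ => ⟨integrable_zero_measure, ?_⟩⟩
    have h := abs_setIntegral_pow_add_two_le hint k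
    rw [← hV, mul_zero] at h
    rw [integral_zero_measure, abs_nonpos_iff.1 h]
  obtain ⟨ι, _, z, w, hz, -, hw, hw1, hwx⟩ :=
    eq_pos_convex_span_of_mem_convexHull (moments_mem_convexHull hd hint hV hpos)
  set V := truncatedSecondMoment ν ε with hVdef
  have hz' : ∀ i, ∃ y, (η ≤ |y| ∧ |y| ≤ ε) ∧ (fun k : Fin d => y ^ (k : ℕ)) = z i :=
    fun i => hz (mem_range_self i)
  choose y hy hyz using hz'
  have hysq : ∀ i, η ^ 2 ≤ y i ^ 2 := fun i => by
    rw [← sq_abs (y i)]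
    exact pow_le_pow_left₀ hη.le (hy i).1 2
  have hysq0 : ∀ i, 0 < y i ^ 2 := fun i => lt_of_lt_of_le (by positivity) (hysq i)
  have hcoef : ∀ i, 0 ≤ V * w i / y i ^ 2 := fun i =>
    div_nonneg (mul_nonneg hV0 (hw i).le) (hysq0 i).le
  have hi : ∀ k : ℕ, ∀ i, Integrable (fun x : ℝ => x ^ (k + 2))
      (ENNReal.ofReal (V * w i / y i ^ 2) • Measure.dirac (y i)) := fun k i =>
    (integrable_dirac (by simp)).smul_measure ENNReal.ofReal_ne_top
  refine ⟨∑ i, ENNReal.ofReal (V * w i / y i ^ 2) • Measure.dirac (y i), ?_, fun k hk =>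
    ⟨integrable_finsetSum_measure.2 fun i _ => hi k i, ?_⟩⟩
  · simp only [Measure.coe_finsetSum, Finset.sum_apply, Measure.smul_apply, measure_univ,
      smul_eq_mul, mul_one]
    rw [← ENNReal.ofReal_sum_of_nonneg fun i _ => hcoef i]
    refine ENNReal.ofReal_le_ofReal ?_
    calc ∑ i, V * w i / y i ^ 2 ≤ ∑ i, V * w i / η ^ 2 :=
          Finset.sum_le_sum fun i _ => div_le_div_of_nonneg_left
            (mul_nonneg hV0 (hw i).le) (by positivity) (hysq i)
      _ = V / η ^ 2 := by rw [← Finset.sum_div, ← Finset.mul_sum, hw1, mul_one]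
  · rw [integral_finsetSum_measure fun i _ => hi k i]
    have hwk := congrFun hwx ⟨k, hk⟩
    simp only [Finset.sum_apply, Pi.smul_apply, ← hyz, smul_eq_mul] at hwk
    rw [eq_div_iff hV.ne'] at hwk
    rw [← hwk, Finset.sum_mul]
    refine Finset.sum_congr rfl fun i _ => ?_
    rw [integral_smul_measure, integral_dirac, ENNReal.toReal_ofReal (hcoef i), smul_eq_mul,
      pow_add]
    have : y i ≠ 0 := sq_pos_iff.1 (hysq0 i)
    field_simp

end Matching

/-- Regular variation makes the moment matching uniform in the truncation level: for small `ε` the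
moments of order `2, …, n` of `ν` restricted to `|y| ≤ ε` are those of a measure whose mass is at
most a constant multiple of `ν {|y| > ε}`. The annulus is `ε / 2 ^ m ≤ |y| ≤ ε`, where `m` is so
large that the second moment over `|y| ≤ ε / 2 ^ m` is dominated by the mass of `n - 1` separated
shells in `ε / 2 ≤ |y| ≤ ε`. -/
theorem IsLevyMeasure.exists_matching_measure {ν : Measure ℝ} (hν : IsLevyMeasure ν) {α : ℝ}
    {g : ℝ → ℝ} {cp cm : ℝ} (hR : RegularVariationAssumption ν α g cp cm) {n : ℕ} (hn : 2 ≤ n) :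
    ∃ K : ℝ, 0 < K ∧ ∀ᶠ ε in 𝓝[>] (0 : ℝ),
      IntegrableOn (fun y : ℝ => y ^ 2) {y | |y| ≤ ε} ν ∧
      truncatedSecondMoment ν ε ≤ K * (ε ^ 2 * levyTail ν ε) ∧
      ∃ μ : Measure ℝ, μ univ ≤ ENNReal.ofReal (K * levyTail ν ε) ∧
        ∀ k, 2 ≤ k → k ≤ n → Integrable (fun y : ℝ => y ^ k) μ ∧
          ∫ y, y ^ k ∂μ = ∫ y in {y | |y| ≤ ε}, y ^ k ∂ν := by
  have hU := hν.isRegularTail_levyTail hR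
  obtain ⟨d, hdn⟩ : ∃ d, n = d + 1 := ⟨n - 1, by omega⟩
  have hd : 0 < d := by omega
  have hd' : (1 : ℝ) ≤ d := by exact_mod_cast hd
  have : Nonempty (Fin d) := ⟨⟨0, hd⟩⟩
  set s : ℝ := 1 / (4 * d) with hs
  have hs0 : 0 < s := by positivity
  have hsd : 4 * d * s = 1 := by rw [hs]; field_simp
  have hs2 : s ≤ 2 := by nlinarith
  let a : Fin d → ℝ := fun i => 1 / 2 + 2 * (i : ℕ) * s
  let b : Fin d → ℝ := fun i => 1 / 2 + (2 * (i : ℕ) + 1) * s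
  have hi : ∀ i : Fin d, ((i : ℕ) : ℝ) + 1 ≤ d := fun i => by exact_mod_cast i.isLt
  have ha : ∀ i, 1 / 2 ≤ a i := fun i => by
    simp only [a, le_add_iff_nonneg_right]
    positivity
  have hab : ∀ i, a i < b i := fun i => by
    simp only [a, b]
    linarith
  have hb : ∀ i, b i ≤ 1 := fun i => by
    simp only [b]
    nlinarith [hi i]
  have hsep : ∀ i j, i < j → b i + s ≤ a j := fun i j hij => by
    have : ((i : ℕ) : ℝ) + 1 ≤ (j : ℕ) := by exact_mod_cast hij
    simp only [a, b]
    nlinarith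
  obtain ⟨σ, hσ, hshell⟩ := hν.exists_side_shell hR
  choose κ hκ0 hκ using fun i => hshell (a i) (b i) (by linarith [ha i]) (hab i)
  obtain ⟨i₀, hi₀⟩ := Finite.exists_min κ
  obtain ⟨K, hK0, q, hq0, hq1, hKq⟩ :=
    hν.exists_truncatedSecondMoment_le hU hR.alpha_mem.2
  obtain ⟨m, hm, hm2⟩ : ∃ m : ℕ, (2 / s) ^ d * K * q ^ m < κ i₀ / 4 ∧ 2 ≤ m := by
    have hlim : Tendsto (fun m : ℕ => (2 / s) ^ d * K * q ^ m) atTop (𝓝 0) := by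
      simpa using (tendsto_pow_atTop_nhds_zero_of_lt_one hq0 hq1).const_mul ((2 / s) ^ d * K)
    exact ((hlim.eventually (gt_mem_nhds (by linarith [hκ0 i₀]))).and
      (eventually_ge_atTop 2)).exists
  have h2m : (2 : ℝ) < 2 ^ m := by
    calc (2 : ℝ) < 2 ^ 2 := by norm_num
      _ ≤ 2 ^ m := pow_le_pow_right₀ (by norm_num) hm2
  refine ⟨K * (2 ^ m) ^ 2, by positivity, ?_⟩
  filter_upwards [hKq, eventually_all.2 hκ, self_mem_nhdsWithin, hU.pos,
    Ioo_mem_nhdsGT zero_lt_one] with ε hε1 hε2 hε3 hε4 hε5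
  have hε : 0 < ε := hε3
  have hint := hν.integrableOn_sq hε5.2.le
  have hV : truncatedSecondMoment ν ε ≤ K * (ε ^ 2 * levyTail ν ε) := by simpa using hε1 0
  refine ⟨hint, hV.trans ?_, ?_⟩
  · refine mul_le_mul_of_nonneg_right ?_ (by positivity)
    exact le_mul_of_one_le_right hK0.le (one_le_pow₀ (by linarith))
  have hη : 0 < ε / 2 ^ m := by positivity
  obtain ⟨μ, hμ, hmom⟩ := exists_measure_moments_eq (ε := ε) hη hd hint fun r hr hr0 =>
    setIntegral_eval_mul_sq_nonneg hr hη (div_lt_div_of_pos_left hε (by norm_num) h2m) hs0 hs2 hσ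
      hint (hν.measure_abs_gt_lt_top hη) ha (fun i => (hab i).le) hb hsep
      (fun i => (mul_le_mul_of_nonneg_right (hi₀ i) hε4.le).trans (hε2 i))
      (by
        have h1 : (2 / s) ^ d * truncatedSecondMoment ν (ε / 2 ^ m)
            ≤ (2 / s) ^ d * (K * q ^ m * (ε ^ 2 * levyTail ν ε)) :=
          mul_le_mul_of_nonneg_left (hε1 m) (by positivity)
        have h2 : (2 / s) ^ d * K * q ^ m * (ε ^ 2 * levyTail ν ε)
            ≤ κ i₀ / 4 * (ε ^ 2 * levyTail ν ε) :=
          mul_le_mul_of_nonneg_right hm.le (by positivity)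
        linarith) hr0
  refine ⟨μ, hμ.trans (ENNReal.ofReal_le_ofReal ?_), fun k hk2 hkn => ?_⟩
  · rw [div_le_iff₀ (by positivity)]
    calc truncatedSecondMoment ν ε ≤ K * (ε ^ 2 * levyTail ν ε) := hV
      _ = K * (2 ^ m) ^ 2 * levyTail ν ε * (ε / 2 ^ m) ^ 2 := by field_simp
  · obtain ⟨j, rfl⟩ : ∃ j, k = j + 2 := ⟨k - 2, by omega⟩
    exact hmom j (by omega)

/-! ### The optimal error at a fixed truncation level -/

/-- On the positive part of a Hahn decomposition the difference of measures is the difference of the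
masses, and the negative part can only decrease the left-hand side. -/
theorem MeasureTheory.Measure.le_sub_apply_of_isFiniteMeasure {X : Type*} [MeasurableSpace X]
    (μ ν : Measure X) [IsFiniteMeasure μ] [IsFiniteMeasure ν] :
    μ univ - ν univ ≤ (μ - ν) univ := by
  obtain ⟨s, hs, hpos, hneg⟩ := hahn_decomposition μ ν
  have hle : ν.restrict s ≤ μ.restrict s := Measure.le_iff.2 fun t ht => by
    rw [Measure.restrict_apply ht, Measure.restrict_apply ht]
    exact hpos _ (ht.inter hs) inter_subset_right
  calc μ univ - ν univ ≤ (μ s + ν sᶜ) - (ν s + ν sᶜ) := by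
        rw [measure_add_measure_compl hs, ← measure_add_measure_compl (μ := μ) hs]
        exact tsub_le_tsub_right (add_le_add le_rfl (hneg _ hs.compl Subset.rfl)) _
    _ = μ s - ν s := ENNReal.add_sub_add_eq_sub_right (measure_ne_top ν _)
    _ = (μ - ν).restrict s univ := by
        rw [Measure.restrict_sub_eq_restrict_sub_restrict hs, Measure.sub_apply .univ hle,
          Measure.restrict_apply_univ, Measure.restrict_apply_univ]
    _ ≤ (μ - ν) univ := Measure.restrict_apply_le _ _

/-- The difference of measures dominates the difference of the masses. -/
theorem MeasureTheory.Measure.le_sub_apply {X : Type*} [MeasurableSpace X]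
    (μ ν : Measure X) [IsFiniteMeasure ν] {s : Set X} (hs : MeasurableSet s) (hμs : μ s ≠ ∞) :
    μ s - ν s ≤ (μ - ν) s := by
  have : IsFiniteMeasure (μ.restrict s) := isFiniteMeasure_restrict.2 hμs
  have h := le_sub_apply_of_isFiniteMeasure (μ.restrict s) (ν.restrict s)
  rwa [← Measure.restrict_sub_eq_restrict_sub_restrict hs, Measure.restrict_apply_univ,
    Measure.restrict_apply_univ, Measure.restrict_apply_univ] at h

/-- An admissible measure has mass `Λ`, hence misses at least the mass `ν {|y| > x} - Λ`
of `ν` beyond distance `x` from the origin. -/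
theorem IsLevyMeasure.le_optimalError {ν : Measure ℝ} (hν : IsLevyMeasure ν) (n : ℕ) {x Λ : ℝ}
    (hx : 0 < x) (hΛ : 0 ≤ Λ) :
    ENNReal.ofReal (x ^ n * (levyTail ν x - Λ)) ≤ optimalError n ν Λ := by
  refine le_iInf₂ fun ν' hν' => ?_
  have : IsFiniteMeasure ν' := ⟨by rw [hν'.1]; exact ENNReal.ofReal_lt_top⟩
  have hfin := (hν.measure_abs_gt_lt_top hx).ne
  calc ENNReal.ofReal (x ^ n * (levyTail ν x - Λ))
      = ENNReal.ofReal (x ^ n) * (ν {y | x < |y|} - ENNReal.ofReal Λ) := by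
        rw [ENNReal.ofReal_mul (by positivity), ENNReal.ofReal_sub _ hΛ, levyTail,
          ofReal_measureReal hfin]
    _ ≤ ENNReal.ofReal (x ^ n) * (ν {y | x < |y|} - ν' {y | x < |y|}) := by
        gcongr
        rw [← hν'.1]
        exact measure_mono (subset_univ _)
    _ ≤ ENNReal.ofReal (x ^ n) * (ν - ν') {y | x < |y|} := by
        gcongr
        exact Measure.le_sub_apply ν ν' (measurableSet_abs_gt x) hfin
    _ = ∫⁻ _ in {y | x < |y|}, ENNReal.ofReal (x ^ n) ∂(ν - ν') := by
        rw [setLIntegral_const]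
    _ ≤ ∫⁻ y in {y | x < |y|}, ENNReal.ofReal (|y| ^ n) ∂(ν - ν') := by
        refine setLIntegral_mono' (measurableSet_abs_gt x) fun y hy => ?_
        exact ENNReal.ofReal_le_ofReal (pow_le_pow_left₀ hx.le (le_of_lt hy) n)
    _ ≤ ∫⁻ y, ENNReal.ofReal (|y| ^ n) ∂(ν - ν') := setLIntegral_le_lintegral _ _
    _ ≤ errorFunctional n ν ν' := by
        rw [errorFunctional, variationOfDiff, lintegral_add_measure]
        exact le_self_add

theorem IsLevyMeasure.integrable_pow {ν : Measure ℝ} (hν : IsLevyMeasure ν) {n k : ℕ}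
    (hmom : Integrable (fun y : ℝ => |y| ^ n) ν) (hk : 2 ≤ k) (hkn : k ≤ n) :
    Integrable (fun y : ℝ => y ^ k) ν := by
  refine Integrable.mono' (hν.integrable_min.add hmom) (by fun_prop)
    (Eventually.of_forall fun y => ?_)
  rw [Real.norm_eq_abs, abs_pow, Pi.add_apply]
  rcases le_total |y| 1 with h | h
  · rw [min_eq_right ((sq_le_one_iff_abs_le_one y).2 h), ← sq_abs y]
    exact (pow_le_pow_of_le_one (abs_nonneg y) h hk).trans
      (le_add_of_nonneg_right (by positivity))
  · exact (pow_le_pow_right₀ h hkn).trans (le_add_of_nonneg_left (by positivity))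

/-- The competitor for the upper bound: `ν` on `|y| > ε`, a measure `μ` that matches the moments
of the remaining part of `ν`, and a mass at the origin, invisible to the moments of positive order
and to the error, that completes the total mass to `Λ`. -/
theorem optimalError_le {ν μ : Measure ℝ} {n : ℕ} (hn : Even n) (hn2 : 2 ≤ n) {ε Λ : ℝ}
    (hpow : ∀ k, 2 ≤ k → k ≤ n → Integrable (fun y : ℝ => y ^ k) ν)
    (hint : IntegrableOn (fun y : ℝ => y ^ 2) {y | |y| ≤ ε} ν)
    (hmass : ν {y | ε < |y|} + μ univ ≤ ENNReal.ofReal Λ)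
    (hmom : ∀ k, 2 ≤ k → k ≤ n → Integrable (fun y : ℝ => y ^ k) μ ∧
      ∫ y, y ^ k ∂μ = ∫ y in {y | |y| ≤ ε}, y ^ k ∂ν) :
    optimalError n ν Λ ≤ ENNReal.ofReal (2 * (ε ^ (n - 2) * truncatedSecondMoment ν ε)) := by
  set m : ℝ≥0∞ := ENNReal.ofReal Λ - (ν {y | ε < |y|} + μ univ) with hm
  have hmtop : m ≠ ∞ := (tsub_le_self.trans_lt ENNReal.ofReal_lt_top).ne
  have hcompl : {y : ℝ | |y| ≤ ε}ᶜ = {y | ε < |y|} := by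
    ext y
    simp
  set ρ : Measure ℝ := μ + m • Measure.dirac 0 with hρ
  have hδ : ∀ k : ℕ, Integrable (fun y : ℝ => y ^ k) (m • Measure.dirac 0) := fun k =>
    (integrable_dirac (by simp)).smul_measure hmtop
  have hadm : ν.restrict {y | ε < |y|} + ρ ∈ admissibleMeasures n ν Λ := by
    refine ⟨?_, fun k hk2 hkn => ?_⟩
    · simp only [hρ, Measure.add_apply, Measure.restrict_apply_univ, Measure.smul_apply,
        measure_univ, smul_eq_mul, mul_one]
      rw [← add_assoc, hm, add_tsub_cancel_of_le hmass]
    · have hk := hpow k hk2 hkn.le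
      obtain ⟨hμk, hμeq⟩ := hmom k hk2 hkn.le
      refine ⟨hk.restrict.add_measure (hμk.add_measure (hδ k)), ?_⟩
      rw [integral_add_measure hk.restrict (hμk.add_measure (hδ k)),
        integral_add_measure hμk (hδ k), integral_smul_measure, integral_dirac,
        zero_pow (by omega), smul_zero, add_zero, hμeq, add_comm, ← hcompl]
      exact integral_add_compl (measurableSet_abs_le ε) hk
  refine (iInf₂_le _ hadm).trans ?_
  have h1 : ν - (ν.restrict {y | ε < |y|} + ρ) ≤ ν.restrict {y | |y| ≤ ε} := by
    refine Measure.sub_le_of_le_add ?_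
    rw [← add_assoc, ← hcompl, Measure.restrict_add_restrict_compl (measurableSet_abs_le ε)]
    exact Measure.le_add_right le_rfl
  have h2 : ν.restrict {y | ε < |y|} + ρ - ν ≤ ρ := by
    refine Measure.sub_le_of_le_add ?_
    rw [add_comm]
    exact add_le_add le_rfl Measure.restrict_le_self
  obtain ⟨j, rfl⟩ : ∃ j, n = j + 2 := ⟨n - 2, by omega⟩
  have hνint : ∫⁻ y in {y | |y| ≤ ε}, ENNReal.ofReal (|y| ^ (j + 2)) ∂ν
      = ENNReal.ofReal (∫ y in {y | |y| ≤ ε}, y ^ (j + 2) ∂ν) := by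
    simp only [hn.pow_abs]
    exact (ofReal_integral_eq_lintegral_ofReal (integrableOn_pow_add_two hint j)
      (Eventually.of_forall fun y => hn.pow_nonneg y)).symm
  have hρint : ∫⁻ y, ENNReal.ofReal (|y| ^ (j + 2)) ∂ρ
      = ENNReal.ofReal (∫ y in {y | |y| ≤ ε}, y ^ (j + 2) ∂ν) := by
    rw [hρ, lintegral_add_measure, lintegral_smul_measure, lintegral_dirac, abs_zero,
      zero_pow (by omega), ENNReal.ofReal_zero, smul_zero, add_zero, ← (hmom _ hn2 le_rfl).2]
    simp only [hn.pow_abs]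
    exact (ofReal_integral_eq_lintegral_ofReal (hmom _ hn2 le_rfl).1
      (Eventually.of_forall fun y => hn.pow_nonneg y)).symm
  have hnonneg : 0 ≤ ∫ y in {y | |y| ≤ ε}, y ^ (j + 2) ∂ν :=
    integral_nonneg fun y => hn.pow_nonneg y
  calc errorFunctional (j + 2) ν (ν.restrict {y | ε < |y|} + ρ)
      ≤ ∫⁻ y, ENNReal.ofReal (|y| ^ (j + 2)) ∂(ν.restrict {y | |y| ≤ ε} + ρ) :=
        lintegral_mono' (add_le_add h1 h2) le_rfl
    _ = ENNReal.ofReal (2 * ∫ y in {y | |y| ≤ ε}, y ^ (j + 2) ∂ν) := by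
        rw [lintegral_add_measure, hνint, hρint, ← ENNReal.ofReal_add hnonneg hnonneg, two_mul]
    _ ≤ _ := by
        refine ENNReal.ofReal_le_ofReal (mul_le_mul_of_nonneg_left ?_ zero_le_two)
        exact (le_abs_self _).trans (abs_setIntegral_pow_add_two_le hint j)

/-! ### The rate of the optimal error -/

section Rate

variable {ν : Measure ℝ} {α : ℝ} {g h : ℝ → ℝ} {cp cm : ℝ} {n : ℕ}

theorem IsAsymptoticInverse.tendsto_levyTail_comp (hν : IsLevyMeasure ν)
    (hR : RegularVariationAssumption ν α g cp cm) (hh : IsAsymptoticInverse g h) :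
    Tendsto (fun Λ => levyTail ν (h Λ) / Λ) atTop (𝓝 (cp + cm)) := by
  obtain ⟨δ, hδ, hgpos, -⟩ := hR.regularlyVarying.pos_measurable
  have hlim := ((hν.tendsto_levyTail_div hR).comp hh.tendsto_zero).mul hh.tendsto_comp
  rw [mul_one] at hlim
  refine hlim.congr' ?_
  filter_upwards [hh.tendsto_zero.eventually (Ioo_mem_nhdsGT hδ)] with Λ hΛ
  have := hgpos _ hΛ
  simp only [Function.comp]
  field_simp

theorem IsAsymptoticInverse.isRegularlyVaryingAtTop_errorRate (hν : IsLevyMeasure ν)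
    (hR : RegularVariationAssumption ν α g cp cm) (hh : IsAsymptoticInverse g h) :
    IsRegularlyVaryingAtTop (errorRate n h) (1 - n / α) := by
  have hα := hR.alpha_mem.1
  refine ⟨?_, fun l hl => ?_⟩
  · obtain ⟨X, hX⟩ := hh.measurable
    obtain ⟨Y, hY⟩ := eventually_atTop.1 (hh.tendsto_zero.eventually self_mem_nhdsWithin)
    refine ⟨max (max X Y) 0, fun x hx => ?_, ?_⟩
    · have hx' : max (max X Y) 0 < x := hx
      have h1 : 0 < h x :=
        hY x (((le_max_right X Y).trans (le_max_left _ 0)).trans hx'.le)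
      exact mul_pos (pow_pos h1 n) ((le_max_right _ _).trans_lt hx')
    · refine AEMeasurable.mul (AEMeasurable.pow_const (hX.mono_measure ?_) n) aemeasurable_id
      exact Measure.restrict_mono
        (Ioi_subset_Ioi ((le_max_left X Y).trans (le_max_left _ 0))) le_rfl
  · have hlim := (hν.isRegularTail_levyTail hR).tendsto_inverse_ratio hα hR.sum_pos hl
      hh.tendsto_zero (hh.tendsto_levyTail_comp hν hR)
    have hlim2 := (hlim.pow n).mul_const l
    have hval : (l ^ (-(1 / α))) ^ n * l = l ^ (1 - n / α) := by
      rw [← Real.rpow_natCast, ← Real.rpow_mul hl.le, ← Real.rpow_add_one hl.ne']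
      congr 1
      ring
    rw [hval] at hlim2
    refine hlim2.congr' ?_
    filter_upwards [eventually_gt_atTop 0,
      hh.tendsto_zero.eventually self_mem_nhdsWithin] with Λ h1 h2
    have h2' : 0 < h Λ := h2
    simp only [errorRate, div_pow]
    field_simp

theorem IsAsymptoticInverse.exists_rate_le_optimalError (hν : IsLevyMeasure ν)
    (hR : RegularVariationAssumption ν α g cp cm) (hh : IsAsymptoticInverse g h) (n : ℕ) :
    ∃ c : ℝ, 0 < c ∧ ∀ᶠ Λ : ℝ in atTop,
      ENNReal.ofReal (c * errorRate n h Λ) ≤ optimalError n ν Λ := by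
  have hα := hR.alpha_mem.1
  have hU := hν.isRegularTail_levyTail hR
  have hUh := hh.tendsto_levyTail_comp hν hR
  -- at distance `a h Λ` the tail of `ν` is at least twice the available mass `Λ`
  obtain ⟨a, ha, ha0⟩ : ∃ a : ℝ, 2 < a ^ (-α) * (cp + cm) ∧ 0 < a := by
    have hlim : Tendsto (fun a : ℝ => a ^ (-α) * (cp + cm)) (𝓝[>] 0) atTop :=
      (tendsto_rpow_neg_nhdsGT_zero (by linarith)).atTop_mul_const hR.sum_pos
    exact ((hlim.eventually_gt_atTop 2).and self_mem_nhdsWithin).exists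
  refine ⟨a ^ n, by positivity, ?_⟩
  filter_upwards [(hU.ratio_comp ha0 hh.tendsto_zero hUh).eventually (lt_mem_nhds ha),
    eventually_gt_atTop 0, hh.tendsto_zero.eventually self_mem_nhdsWithin] with Λ h1 h2 h3
  have h3' : 0 < h Λ := h3
  refine le_trans (ENNReal.ofReal_le_ofReal ?_)
    (hν.le_optimalError n (mul_pos ha0 h3') h2.le)
  rw [lt_div_iff₀ h2] at h1
  rw [errorRate, ← mul_assoc, ← mul_pow]
  exact mul_le_mul_of_nonneg_left (by linarith) (by positivity)

theorem IsAsymptoticInverse.exists_optimalError_le_rate (hν : IsLevyMeasure ν)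
    (hR : RegularVariationAssumption ν α g cp cm) (hh : IsAsymptoticInverse g h)
    (hn : Even n) (hn2 : 2 ≤ n) (hmom : Integrable (fun y : ℝ => |y| ^ n) ν) :
    ∃ C : ℝ, 0 < C ∧ ∀ᶠ Λ : ℝ in atTop,
      optimalError n ν Λ ≤ ENNReal.ofReal (C * errorRate n h Λ) := by
  have hα := hR.alpha_mem.1
  have hU := hν.isRegularTail_levyTail hR
  have hUh := hh.tendsto_levyTail_comp hν hR
  obtain ⟨K, hK0, hK⟩ := hν.exists_matching_measure hR hn2
  -- truncating at `A h Λ` leaves room for the tail and the matching measure within the mass `Λ`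
  obtain ⟨A, hA, hA0⟩ : ∃ A : ℝ, A ^ (-α) * (cp + cm) < 1 / (1 + K) ∧ 0 < A := by
    have hlim : Tendsto (fun a : ℝ => a ^ (-α) * (cp + cm)) atTop (𝓝 0) := by
      simpa using (tendsto_rpow_neg_atTop hα).mul_const (cp + cm)
    exact ((hlim.eventually (gt_mem_nhds (by positivity))).and (eventually_gt_atTop 0)).exists
  refine ⟨2 * K * A ^ n, by positivity, ?_⟩
  have hAh : Tendsto (fun Λ => A * h Λ) atTop (𝓝[>] 0) :=
    (tendsto_const_mul_nhdsGT_zero hA0).comp hh.tendsto_zero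
  filter_upwards [(hU.ratio_comp hA0 hh.tendsto_zero hUh).eventually (gt_mem_nhds hA),
    eventually_gt_atTop 0, hAh.eventually self_mem_nhdsWithin, hAh.eventually hK,
    hAh.eventually hU.pos] with Λ h1 h2 h3 h4 h5
  obtain ⟨hint, hV, μ, hμ, hμmom⟩ := h4
  have h3' : 0 < A * h Λ := h3
  rw [div_lt_div_iff₀ h2 (by positivity)] at h1
  have hmass : ν {y | A * h Λ < |y|} + μ univ ≤ ENNReal.ofReal Λ := by
    rw [← ofReal_measureReal (hν.measure_abs_gt_lt_top h3').ne]
    refine (add_le_add le_rfl hμ).trans ?_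
    rw [← ENNReal.ofReal_add measureReal_nonneg (by positivity)]
    refine ENNReal.ofReal_le_ofReal ?_
    change levyTail ν (A * h Λ) + K * levyTail ν (A * h Λ) ≤ Λ
    linarith
  refine (optimalError_le hn hn2 (fun k hk2 hkn => hν.integrable_pow hmom hk2 hkn) hint hmass
    hμmom).trans (ENNReal.ofReal_le_ofReal ?_)
  have hUle : levyTail ν (A * h Λ) ≤ Λ := by nlinarith
  calc 2 * ((A * h Λ) ^ (n - 2) * truncatedSecondMoment ν (A * h Λ))
      ≤ 2 * ((A * h Λ) ^ (n - 2) * (K * ((A * h Λ) ^ 2 * Λ))) := by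
        have : truncatedSecondMoment ν (A * h Λ) ≤ K * ((A * h Λ) ^ 2 * Λ) :=
          hV.trans (by gcongr)
        gcongr
    _ = 2 * K * ((A * h Λ) ^ (n - 2 + 2) * Λ) := by ring
    _ = 2 * K * A ^ n * errorRate n h Λ := by
        rw [Nat.sub_add_cancel hn2, errorRate, mul_pow]
        ring

/-- Since `Λ ≲ (h Λ) ^ (-β)` for every `β > α`, the rate is `O(Λ ^ (1 - n / β))`. -/
theorem IsAsymptoticInverse.tendsto_rpow_mul_errorRate (hν : IsLevyMeasure ν)
    (hR : RegularVariationAssumption ν α g cp cm) (hh : IsAsymptoticInverse g h)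
    {p : ℝ} (hp : p < n / α - 1) :
    Tendsto (fun Λ : ℝ => Λ ^ p * errorRate n h Λ) atTop (𝓝 0) := by
  have hα := hR.alpha_mem.1
  have hc := hR.sum_pos
  have hU := hν.isRegularTail_levyTail hR
  have hUh := hh.tendsto_levyTail_comp hν hR
  obtain ⟨β, hβ, hαβ⟩ : ∃ β : ℝ, p + 1 < n / β ∧ α < β := by
    have hlim : Tendsto (fun β : ℝ => (n : ℝ) / β) (𝓝[>] α) (𝓝 (n / α)) :=
      (tendsto_const_nhds.div tendsto_id hα.ne').mono_left nhdsWithin_le_nhds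
    exact ((hlim.eventually (lt_mem_nhds (by linarith))).and self_mem_nhdsWithin).exists
  have hβ0 : 0 < β := hα.trans hαβ
  obtain ⟨C, hC0, hC⟩ := hU.exists_le_rpow hα hαβ
  set D : ℝ := C * (2 / (cp + cm)) with hD
  have hD0 : 0 < D := by positivity
  have hlim : Tendsto (fun Λ : ℝ => D ^ (n / β) * Λ ^ (-(n / β - (p + 1)))) atTop (𝓝 0) := by
    simpa using (tendsto_rpow_neg_atTop (sub_pos.2 hβ)).const_mul (D ^ (n / β))
  refine tendsto_of_tendsto_of_tendsto_of_le_of_le' tendsto_const_nhds hlim ?_ ?_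
  · filter_upwards [eventually_gt_atTop 0, hh.tendsto_zero.eventually self_mem_nhdsWithin]
      with Λ h1 h2
    have h2' : 0 < h Λ := h2
    rw [errorRate]
    positivity
  · filter_upwards [eventually_gt_atTop 0, hh.tendsto_zero.eventually self_mem_nhdsWithin,
      hUh.eventually (lt_mem_nhds (half_lt_self hc)), hh.tendsto_zero.eventually hC]
      with Λ h1 h2 h3 h4
    have h2' : 0 < h Λ := h2
    rw [lt_div_iff₀ h1] at h3
    have h5 : h Λ ^ β ≤ D * Λ⁻¹ := by
      rw [Real.rpow_neg h2'.le, ← div_eq_mul_inv, le_div_iff₀ (by positivity)] at h4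
      have h6 : (cp + cm) / 2 * Λ * h Λ ^ β ≤ C :=
        (mul_le_mul_of_nonneg_right h3.le (by positivity)).trans h4
      rw [← div_eq_mul_inv, le_div_iff₀ h1, hD, mul_div_assoc', le_div_iff₀ hc]
      linarith
    have h7 : h Λ ^ n ≤ D ^ (n / β) * Λ ^ (-(n / β)) := by
      calc h Λ ^ n = (h Λ ^ β) ^ (n / β) := by
            rw [← Real.rpow_mul h2'.le, mul_div_cancel₀ _ hβ0.ne', Real.rpow_natCast]
        _ ≤ (D * Λ⁻¹) ^ (n / β) := Real.rpow_le_rpow (by positivity) h5 (by positivity)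
        _ = D ^ (n / β) * Λ ^ (-(n / β)) := by
            rw [Real.mul_rpow hD0.le (by positivity), Real.inv_rpow h1.le, Real.rpow_neg h1.le]
    calc Λ ^ p * errorRate n h Λ ≤ Λ ^ p * (D ^ (n / β) * Λ ^ (-(n / β)) * Λ) := by
          rw [errorRate]
          gcongr
      _ = D ^ (n / β) * (Λ ^ (-(n / β)) * (Λ ^ p * Λ)) := by ring
      _ = D ^ (n / β) * Λ ^ (-(n / β - (p + 1))) := by
          rw [← Real.rpow_add_one h1.ne', ← Real.rpow_add h1]
          congr 2
          ring

end Rate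

theorem mainTheorem2 (n : ℕ) (hn : Even n) (hn2 : 2 ≤ n)
    (ν : Measure ℝ) (hν : IsLevyMeasure ν) (hmom : Integrable (fun y : ℝ => |y| ^ n) ν)
    (α : ℝ) (g : ℝ → ℝ) (cp cm : ℝ) (hR : RegularVariationAssumption ν α g cp cm) :
    -- `g^← = inf {x > 0 : g x < Λ}` is a generalized inverse
    IsAsymptoticInverse g (generalizedInverse g) ∧
    -- the rate is regularly varying, with two-sided bounds, for each generalized inverse
    (∀ h : ℝ → ℝ, IsAsymptoticInverse g h →
      IsRegularlyVaryingAtTop (errorRate n h) (1 - n / α) ∧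
      ∃ c C : ℝ, 0 < c ∧ c ≤ C ∧ ∀ᶠ Λ : ℝ in atTop,
        ENNReal.ofReal (c * errorRate n h Λ) ≤ optimalError n ν Λ ∧
        optimalError n ν Λ ≤ ENNReal.ofReal (C * errorRate n h Λ)) ∧
    -- every order of convergence below `n / α - 1` is reached
    (∀ p : ℝ, p < n / α - 1 →
      Tendsto (fun Λ : ℝ => ENNReal.ofReal (Λ ^ p) * optimalError n ν Λ) atTop (𝓝 0)) := by
  have hinv : IsAsymptoticInverse g (generalizedInverse g) :=
    (hν.isRegularTail_levyTail hR).isAsymptoticInverse_generalizedInverse hR.alpha_mem.1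
      hR.sum_pos hR.regularlyVarying (hν.tendsto_levyTail_div hR)
  refine ⟨hinv, fun h hh => ⟨hh.isRegularlyVaryingAtTop_errorRate hν hR, ?_⟩, fun p hp => ?_⟩
  · obtain ⟨c, hc, hlow⟩ := hh.exists_rate_le_optimalError hν hR n
    obtain ⟨C, -, hup⟩ := hh.exists_optimalError_le_rate hν hR hn hn2 hmom
    refine ⟨c, max c C, hc, le_max_left _ _, ?_⟩
    filter_upwards [hlow, hup, eventually_gt_atTop 0,
      hh.tendsto_zero.eventually self_mem_nhdsWithin] with Λ h1 h2 h3 h4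
    refine ⟨h1, h2.trans (ENNReal.ofReal_le_ofReal ?_)⟩
    exact mul_le_mul_of_nonneg_right (le_max_right _ _)
      (mul_nonneg (pow_nonneg (le_of_lt h4) n) h3.le)
  · obtain ⟨C, hC, hup⟩ := hinv.exists_optimalError_le_rate hν hR hn hn2 hmom
    have hlim := ENNReal.tendsto_ofReal
      ((hinv.tendsto_rpow_mul_errorRate (n := n) hν hR hp).const_mul C)
    rw [mul_zero, ENNReal.ofReal_zero] at hlim
    refine tendsto_of_tendsto_of_tendsto_of_le_of_le' tendsto_const_nhds hlim
      (Eventually.of_forall fun _ => zero_le) ?_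
    filter_upwards [hup, eventually_gt_atTop 0] with Λ h1 h2
    calc ENNReal.ofReal (Λ ^ p) * optimalError n ν Λ
        ≤ ENNReal.ofReal (Λ ^ p) * ENNReal.ofReal (C * errorRate n (generalizedInverse g) Λ) := by
          gcongr
      _ = ENNReal.ofReal (C * (Λ ^ p * errorRate n (generalizedInverse g) Λ)) := by
          rw [← ENNReal.ofReal_mul (by positivity)]
          congr 1
          ring
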